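/- Let $N\ge 0$, $l\ge 1$ and $2s\ge 1$ be integers, and let $\lambda,u\in\mathbb C$ with $\sinh(k\lambda)\neq 0$ for $1\le k\le l+1$. Notation. For $n\ge 0$ let $V_n=\mathbb C^{n+1}$ (spin $n/2$) with basis $e_0,\dots,e_n$, write $\rho_j=\sqrt{\sinh(j\lambda)}$ (principal square root), and let $S^z=\mathrm{diag}(n,n-2,\dots,-n)$, $S^+e_j=\frac{\rho_j\,\rho_{n+1-j}}{\sinh\lambda}\,e_{j-1}$ for $1\le j\le n$, $S^+e_0=0$, $S^-=(S^+)^t$; for $n=1$ these operators are denoted $\sigma^z,\sigma^\pm$. Put $$R^{(n,1)}(u)=\sinh\!\left(u+\tfrac{\lambda}{2}\,[\,n+S^z\otimes\sigma^z]\right)+\sinh(\lambda)\left[S^+\otimes\sigma^-+S^-\otimes\sigma^+\right]\in \mathrm{End}(V_n\otimes V_1),$$ and let $R^{(1,n)}(u)\in\mathrm{End}(V_1\otimes V_n)$ be the same operator with the tensor factors interchanged. Let $P_n:V_n\otimes V_1\to V_{n+1}$ be the projection onto the symmetrized component, $$P_n(e_j\otimes e_0)=\rho_{n+1-j}\,e_j,\qquad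 P_n(e_j\otimes e_1)=\rho_{j+1}\,e_{j+1},$$ and let $E_n:V_{n+1}\to V_n\otimes V_1$ be its right inverse $E_ne_J=\frac{1}{\sinh((n+1)\lambda)}\left(e^{J\lambda}\rho_{n+1-J}\,e_J\otimes e_0+e^{-(n+1-J)\lambda}\rho_J\,e_{J-1}\otimes e_1\right)$. For $n\le m$ the fused $R$-matrices $R^{(n,m)}(u)\in\mathrm{End}(V_n\otimes V_m)$ are given by $R^{(0,m)}(u)=1$, by $R^{(1,m)}(u)$ above, and recursively by $$R^{(n+1,m)}(u)=(P_n)_{12}\,R^{(n,m)}_{13}(u+\lambda)\,R^{(1,m)}_{23}(u)\,(E_n)_{12}\qquad(1\le n<m);$$ for $n>m$, $R^{(n,m)}(u)$ is $R^{(m,n)}(u)$ with the tensor factors interchanged. Let $F^{(n)}$ be the $(n+1)\times(n+1)$ matrix with $1$ along the anti-diagonal and $0$ elsewhere, and define the twisted transfer matrices on $V_{2s}^{\otimes N}$ by $$t^{(2s)}_n(u)=\mathrm{tr}_a\left(R^{(n,2s)}_{a1}(u)\cdots R^{(n,2s)}_{aN}(u)\,F^{(n)}_a\right),$$ where the auxiliary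 space $a$ is $V_n$. Claim. The transfer matrices satisfy $$t^{(2s)}_l(u+\lambda)\,t^{(2s)}_1(u)=\begin{cases} t^{(2s)}_{l+1}(u)-\sinh^N\! u\;\sinh^N[u+\lambda(2s+1)]\;t^{(2s)}_{l-1}(u+2\lambda), & l<2s,\\[4pt] \sinh^N(u+2s\lambda)\,t^{(2s)}_{l+1}(u)-\sinh^N\! u\;\sinh^N[u+\lambda(2s+1)]\;t^{(2s)}_{l-1}(u+2\lambda), & l=2s,\\[4pt] \sinh^N(u+2s\lambda)\,t^{(2s)}_{l+1}(u)-\sinh^N\! u\;t^{(2s)}_{l-1}(u+2\lambda), & l>2s.\end{cases}$$ -/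

import Mathlib

open scoped Kronecker

noncomputable section

namespace TwistedXXZ

/-- Index set of the standard basis of the spin-`l/2` space, of dimension `l + 1`.
The index `i` labels the vector with `S^z = l - 2 i`. -/
abbrev Idx (l : ℕ) : Type := Fin (l + 1)

/-- The principal square root of `sinh (j λ)`. -/
def root (lam : ℂ) (j : ℕ) : ℂ := Complex.sqrt (Complex.sinh (j * lam))

/-- The number `f(j) = √(sinh (j λ) sinh ((l + 1 - j) λ))`, for `1 ≤ j ≤ l`. The branch is
`√(a b) = √a √b`, so that `f(j)` is exactly `sinh (j λ)` when `2 j = l + 1`; in particular the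
spin-`1/2` operators are the usual Pauli matrices. -/
def f (lam : ℂ) (l j : ℕ) : ℂ := root lam j * root lam (l + 1 - j)

/-- The eigenvalue of `S^z = diag (l, l - 2, …, -l)` on the basis vector `i`. -/
def sz (l : ℕ) (i : Idx l) : ℂ := (l : ℂ) - 2 * ((i : ℕ) : ℂ)

/-- The raising operator `S^+` of `U_q(su(2))` in the spin-`l/2` representation. -/
def Sp (lam : ℂ) (l : ℕ) : Matrix (Idx l) (Idx l) ℂ :=
  Matrix.of fun i j => if (i : ℕ) + 1 = (j : ℕ) then f lam l (j : ℕ) / Complex.sinh lam else 0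

/-- The lowering operator `S^- = (S^+)^t`. -/
def Sm (lam : ℂ) (l : ℕ) : Matrix (Idx l) (Idx l) ℂ := (Sp lam l).transpose

/-- The R-matrix `R^{(l,1)}(u) = sinh (u + (λ/2) (l + S^z ⊗ σ^z)) + sinh λ (S^+ ⊗ σ^- + S^- ⊗ σ^+)`
on the tensor product of the spin-`l/2` and spin-`1/2` spaces. -/
def Rl1 (lam : ℂ) (l : ℕ) (u : ℂ) : Matrix (Idx l × Idx 1) (Idx l × Idx 1) ℂ :=
  Matrix.diagonal (fun p => Complex.sinh (u + lam / 2 * ((l : ℂ) + sz l p.1 * sz 1 p.2))) +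
    Complex.sinh lam • (Sp lam l ⊗ₖ Sm lam 1 + Sm lam l ⊗ₖ Sp lam 1)

/-- Interchange of the two tensor factors of an operator on `V_m ⊗ V_l`. -/
def flip {m l : ℕ} (A : Matrix (Idx m × Idx l) (Idx m × Idx l) ℂ) :
    Matrix (Idx l × Idx m) (Idx l × Idx m) ℂ :=
  A.submatrix Prod.swap Prod.swap

/-- The projection of `V_l ⊗ V_1` (spins `l/2` and `1/2`) onto its symmetrized component `V_{l+1}`.
Its kernel is the kernel of `R^{(l,1)}(λ)`, in fact `R^{(l,1)}(λ)` is `(proj)^t (proj)`. -/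
def proj (lam : ℂ) (l : ℕ) : Matrix (Idx (l + 1)) (Idx l × Idx 1) ℂ :=
  Matrix.of fun J p =>
    if (J : ℕ) = (p.1 : ℕ) + (p.2 : ℕ) then
      (if p.2 = 0 then root lam (l + 1 - (J : ℕ)) else root lam (J : ℕ))
    else 0

/-- A right inverse of `proj`, for `sinh ((l + 1) λ) ≠ 0`. -/
def incl (lam : ℂ) (l : ℕ) : Matrix (Idx l × Idx 1) (Idx (l + 1)) ℂ :=
  Matrix.of fun p J =>
    if (J : ℕ) = (p.1 : ℕ) + (p.2 : ℕ) then
      (if p.2 = 0 then Complex.exp (((J : ℕ) : ℂ) * lam) * root lam (l + 1 - (J : ℕ))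
        else Complex.exp (-(((l + 1 - (J : ℕ) : ℕ) : ℂ) * lam)) * root lam (J : ℕ))
        / Complex.sinh (((l + 1 : ℕ) : ℂ) * lam)
    else 0

/-- `A_{13}` on `V_l ⊗ V_1 ⊗ V_m`, for an operator `A` on `V_l ⊗ V_m`. -/
def emb13 {l m : ℕ} (A : Matrix (Idx l × Idx m) (Idx l × Idx m) ℂ) :
    Matrix ((Idx l × Idx 1) × Idx m) ((Idx l × Idx 1) × Idx m) ℂ :=
  Matrix.of fun p q => if p.1.2 = q.1.2 then A (p.1.1, p.2) (q.1.1, q.2) else 0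

/-- `B_{23}` on `V_l ⊗ V_1 ⊗ V_m`, for an operator `B` on `V_1 ⊗ V_m`. -/
def emb23 (l : ℕ) {m : ℕ} (B : Matrix (Idx 1 × Idx m) (Idx 1 × Idx m) ℂ) :
    Matrix ((Idx l × Idx 1) × Idx m) ((Idx l × Idx 1) × Idx m) ℂ :=
  Matrix.of fun p q => if p.1.1 = q.1.1 then B (p.1.2, p.2) (q.1.2, q.2) else 0

/-- One fusion step: the operator induced by `A_{13} B_{23}` on the symmetrized component
`V_{l+1}` of the first two factors, that is the upper left block of
`D_{12} A_{13} B_{23} D_{12}⁻¹`. In its use below the kernel of `proj` is invariant under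
`A_{13} B_{23}`, so the choice of the right inverse `incl` does not matter. -/
def fuse (lam : ℂ) {l m : ℕ} (A : Matrix (Idx l × Idx m) (Idx l × Idx m) ℂ)
    (B : Matrix (Idx 1 × Idx m) (Idx 1 × Idx m) ℂ) :
    Matrix (Idx (l + 1) × Idx m) (Idx (l + 1) × Idx m) ℂ :=
  (proj lam l ⊗ₖ (1 : Matrix (Idx m) (Idx m) ℂ)) * (emb13 A * emb23 l B) *
    (incl lam l ⊗ₖ (1 : Matrix (Idx m) (Idx m) ℂ))

/-- The `l`-fold fusion of `R^{(1,m)}` in its first factor: `R^{(1,m)}(u)` is `R^{(m,1)}(u)` with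
the factors interchanged, and level `l + 1` at `u` comes from level `l` at `u + λ` and from
`R^{(1,m)}(u)`. -/
def fusedR (lam : ℂ) (m : ℕ) : (l : ℕ) → ℂ → Matrix (Idx l × Idx m) (Idx l × Idx m) ℂ
  | 0, _ => 1
  | 1, u => flip (Rl1 lam m u)
  | l + 2, u => fuse lam (fusedR lam m (l + 1) (u + lam)) (flip (Rl1 lam m u))

/-- The fused R-matrix `R^{(l,m)}(u)` on the tensor product of the spin-`l/2` and spin-`m/2`
spaces. The space of lower spin is the one obtained by fusion of spins `1/2`; the case `l > m` is
reduced to `l ≤ m` by interchanging the two factors. In particular `R^{(l,1)}` is `Rl1`. -/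
def R (lam : ℂ) (l m : ℕ) (u : ℂ) : Matrix (Idx l × Idx m) (Idx l × Idx m) ℂ :=
  if l ≤ m then fusedR lam m l u else flip (fusedR lam l m u)

/-- The charge-conjugation twist `F^{(l)}`: ones on the anti-diagonal, zeros elsewhere. -/
def F (l : ℕ) : Matrix (Idx l) (Idx l) ℂ :=
  Matrix.of fun i j => if (i : ℕ) + (j : ℕ) = l then 1 else 0

/-- `A_{ak}` on `V_a ⊗ V_1 ⊗ ⋯ ⊗ V_N`: the operator `A` acts on the auxiliary space and on the
`k`-th quantum space. -/
def emb {l m : ℕ} (N : ℕ) (A : Matrix (Idx l × Idx m) (Idx l × Idx m) ℂ) (k : Fin N) :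
    Matrix (Idx l × (Fin N → Idx m)) (Idx l × (Fin N → Idx m)) ℂ :=
  open scoped Classical in
  Matrix.of fun p q =>
    if ∀ i, i ≠ k → p.2 i = q.2 i then A (p.1, p.2 k) (q.1, q.2 k) else 0

/-- The monodromy matrix `T^{(l)}(u) = R_{a1}^{(l,m)}(u) ⋯ R_{aN}^{(l,m)}(u)`. -/
def monodromy (lam : ℂ) (N m l : ℕ) (u : ℂ) :
    Matrix (Idx l × (Fin N → Idx m)) (Idx l × (Fin N → Idx m)) ℂ :=
  (List.ofFn fun k : Fin N => emb N (R lam l m u) k).prod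

/-- The partial trace over the auxiliary space. -/
def traceAux {l : ℕ} {Q : Type} (A : Matrix (Idx l × Q) (Idx l × Q) ℂ) : Matrix Q Q ℂ :=
  Matrix.of fun x y => ∑ a, A (a, x) (a, y)

/-- The twisted transfer matrix `t_l^{(m)}(u) = tr_a (T^{(l)}(u) F_a^{(l)})` of the chain with `N`
sites of spin `m/2`. -/
def t (lam : ℂ) (N m l : ℕ) (u : ℂ) : Matrix (Fin N → Idx m) (Fin N → Idx m) ℂ :=
  traceAux (monodromy lam N m l u * (F l ⊗ₖ (1 : Matrix (Fin N → Idx m) (Fin N → Idx m) ℂ)))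

end TwistedXXZ

end

/-! The product of two transfer matrices is a trace over the tensor product of their auxiliary
spaces. With the first spin written as (l+1)/2, this space splits as V_{l+1} ⊗ V_1 = V_{l+2} ⊕ V_l,
through `incl` and `sing`. The singlet part V_l is the kernel of `proj`, and at each site A_{13}
B_{23} preserves it. The monodromy is therefore block triangular, and its trace is the trace over
the quotient V_{l+2} plus the trace over the subspace V_l. The twist acts as F on the quotient and
as -F on the singlet (`proj_mul_F`, `F_mul_sing`), hence the minus sign. Each site contributes one
scalar factor to each part, hence the N-th powers. All this is `transfer_mul_transfer`; what remains
are two local identities per case.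

When V_l is the fused factor, `mul_sing_of_intertwine` turns compatibility with `proj` at one level
into invariance of the singlet at the next, the scalar being the quantum determinant sinh u sinh(u +
(m+1)λ). Invariance in turn gives compatibility with `proj` at that level, which closes an induction
(`proj_mul_fusedR`, `fusedR_mul_sing`).

When the spin of the auxiliary space is the larger one, the R-matrix is fused in the quantum space,
which changes its normalisation and moves sinh factors between the two terms. The local identities
are then lifted from a spin-1/2 quantum space by induction on its spin (`proj_mul_flip_fusedR`,
`flip_fusedR_mul_sing`). The two normalisations agree at equal spins (`flip_fusedR_self`), which
joins the cases at l = 2s. -/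

open scoped Kronecker

noncomputable section

namespace TwistedXXZ

open Complex (sinh cosh)

/-! ### Matrices over a complex algebra -/

section Algebra

variable {α β γ δ ι : Type*} {𝒜 ℬ : Type*} [Ring 𝒜] [Algebra ℂ 𝒜] [Ring ℬ] [Algebra ℂ ℬ]

/-- A complex matrix, viewed as a matrix with scalar entries in an algebra `𝒜`. -/
def scal (𝒜 : Type*) [Ring 𝒜] [Algebra ℂ 𝒜] (M : Matrix α β ℂ) : Matrix α β 𝒜 :=
  M.map (algebraMap ℂ 𝒜)

@[simp] theorem scal_apply (M : Matrix α β ℂ) (i : α) (j : β) :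
    scal 𝒜 M i j = algebraMap ℂ 𝒜 (M i j) := rfl

theorem scal_mul [Fintype β] (M : Matrix α β ℂ) (M' : Matrix β γ ℂ) :
    scal 𝒜 (M * M') = scal 𝒜 M * scal 𝒜 M' := Matrix.map_mul

theorem scal_add (M M' : Matrix α β ℂ) : scal 𝒜 (M + M') = scal 𝒜 M + scal 𝒜 M' := by
  ext; simp

theorem scal_neg (M : Matrix α β ℂ) : scal 𝒜 (-M) = -scal 𝒜 M := by
  ext; simp

@[simp] theorem scal_one [DecidableEq α] : scal 𝒜 (1 : Matrix α α ℂ) = 1 := by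
  simp [scal]

@[simp] theorem scal_zero : scal 𝒜 (0 : Matrix α β ℂ) = 0 := by
  ext; simp

theorem scal_kronecker (M : Matrix α β ℂ) (M' : Matrix γ δ ℂ) :
    scal 𝒜 (M ⊗ₖ M') = scal 𝒜 M ⊗ₖ scal 𝒜 M' := by
  ext; simp

@[simp] theorem map_scal (φ : 𝒜 →ₐ[ℂ] ℬ) (M : Matrix α β ℂ) :
    (scal 𝒜 M).map φ = scal ℬ M := by
  ext; simp

theorem map_kronecker (φ : 𝒜 →ₐ[ℂ] ℬ) (A : Matrix α β 𝒜) (B : Matrix γ δ 𝒜) :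
    (A ⊗ₖ B).map φ = A.map φ ⊗ₖ B.map φ := by
  ext; simp

theorem map_smul_matrix (φ : 𝒜 →ₐ[ℂ] ℬ) (c : ℂ) (A : Matrix α β 𝒜) :
    (c • A).map φ = c • A.map φ := by
  ext; simp

/-- Cyclicity of the trace fails over a noncommutative ring; it survives here because scalar entries
are central. -/
theorem trace_mul_scal_comm [Fintype α] [Fintype β] (X : Matrix α β 𝒜) (M : Matrix β α ℂ) :
    Matrix.trace (X * scal 𝒜 M) = Matrix.trace (scal 𝒜 M * X) := by
  simp only [Matrix.trace, Matrix.diag, Matrix.mul_apply, scal_apply]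
  rw [Finset.sum_comm]
  exact Finset.sum_congr rfl fun _ _ => Finset.sum_congr rfl fun _ _ =>
    (Algebra.commutes _ _).symm

/-- The mixed-product rule over a noncommutative ring: only the entries of the inner factors `A'`
and `B` have to pass each other. -/
theorem mul_kronecker_mul_of_commute {𝒜 : Type*} [Ring 𝒜] [Fintype β] [Fintype δ] {α' γ' : Type*}
    (A : Matrix α β 𝒜) (A' : Matrix β α' 𝒜) (B : Matrix γ δ 𝒜) (B' : Matrix δ γ' 𝒜)
    (h : ∀ i j k l, Commute (A' i j) (B k l)) :
    (A * A') ⊗ₖ (B * B') = (A ⊗ₖ B) * (A' ⊗ₖ B') := by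
  ext ⟨i, k⟩ ⟨j, l⟩
  simp only [Matrix.kronecker_apply, Matrix.mul_apply, Fintype.sum_prod_type,
    Finset.sum_mul_sum]
  refine Finset.sum_congr rfl fun x _ => Finset.sum_congr rfl fun y _ => ?_
  rw [mul_assoc, mul_assoc, ← mul_assoc (A' x j), (h x j k y).eq, mul_assoc]

/-- Products over sites of matrices whose entries at distinct sites commute. -/
theorem list_prod_kronecker_list_prod {𝒜 : Type*} [Ring 𝒜] [Fintype α] [DecidableEq α]
    [Fintype β] [DecidableEq β]
    (A : ι → Matrix α α 𝒜) (B : ι → Matrix β β 𝒜)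
    (h : ∀ s t, s ≠ t → ∀ i j k l, Commute (A s i j) (B t k l)) (L : List ι) (hL : L.Nodup) :
    (L.map A).prod ⊗ₖ (L.map B).prod = (L.map fun s => A s ⊗ₖ B s).prod := by
  induction L with
  | nil => simp
  | cons s L ih =>
    rw [List.nodup_cons] at hL
    simp only [List.map_cons, List.prod_cons]
    rw [mul_kronecker_mul_of_commute, ih hL.2]
    have key : ∀ L' : List ι, s ∉ L' → ∀ i j k l, Commute ((L'.map A).prod i j) (B s k l) := by
      intro L'
      induction L' with
      | nil =>
        intro _ i j k l
        by_cases hij : i = j <;> simp [hij]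
      | cons t L' ih' =>
        intro ht i j k l
        simp only [List.mem_cons, not_or] at ht
        simp only [List.map_cons, List.prod_cons, Matrix.mul_apply]
        exact Commute.sum_left _ _ _ fun x _ =>
          (h t s (Ne.symm ht.1) _ _ _ _).mul_left (ih' ht.2 _ _ _ _)
    exact key L hL.1

/-- The passage from one site to the chain: `M` is pulled through one site at a time, each leaving a
factor `c`. -/
theorem mul_list_prod_of_intertwine [Fintype α] [DecidableEq α] [Fintype β] [DecidableEq β]
    (M : Matrix α β 𝒜) (c : ℂ) (X : ι → Matrix β β 𝒜) (Y : ι → Matrix α α 𝒜)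
    (h : ∀ s, M * X s = c • (Y s * M)) (L : List ι) :
    M * (L.map X).prod = c ^ L.length • ((L.map Y).prod * M) := by
  induction L with
  | nil => simp
  | cons s L ih =>
    simp only [List.map_cons, List.prod_cons, List.length_cons]
    rw [← Matrix.mul_assoc, h, Matrix.smul_mul, Matrix.mul_assoc, ih, Matrix.mul_smul, smul_smul,
      Matrix.mul_assoc, pow_succ']

theorem list_prod_mul_of_intertwine [Fintype α] [DecidableEq α] [Fintype β] [DecidableEq β]
    (M : Matrix α β 𝒜) (c : ℂ) (X : ι → Matrix α α 𝒜) (Y : ι → Matrix β β 𝒜)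
    (h : ∀ s, X s * M = c • (M * Y s)) (L : List ι) :
    (L.map X).prod * M = c ^ L.length • (M * (L.map Y).prod) := by
  induction L with
  | nil => simp
  | cons s L ih =>
    simp only [List.map_cons, List.prod_cons, List.length_cons]
    rw [Matrix.mul_assoc, ih, Matrix.mul_smul, ← Matrix.mul_assoc, h, Matrix.smul_mul, smul_smul,
      Matrix.mul_assoc, pow_succ]

end Algebra

/-! ### Operators on `V ⊗ Q` as matrices of operators on `Q` -/

section Blocks

variable {α β γ : Type*} {Q : Type*}

/-- An operator on `V ⊗ Q`, as a matrix whose entries are operators on `Q`. -/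
def blocks (X : Matrix (α × Q) (β × Q) ℂ) : Matrix α β (Matrix Q Q ℂ) :=
  Matrix.of fun a b => Matrix.of fun i j => X (a, i) (b, j)

@[simp] theorem blocks_apply (X : Matrix (α × Q) (β × Q) ℂ) (a : α) (b : β) (i j : Q) :
    blocks X a b i j = X (a, i) (b, j) := rfl

theorem blocks_injective {X Y : Matrix (α × Q) (β × Q) ℂ} (h : blocks X = blocks Y) : X = Y := by
  ext ⟨a, i⟩ ⟨b, j⟩
  exact congrFun (congrFun (congrFun (congrFun h a) b) i) j

theorem blocks_smul (c : ℂ) (X : Matrix (α × Q) (β × Q) ℂ) : blocks (c • X) = c • blocks X := rfl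

theorem blocks_mul [Fintype β] [Fintype Q] (X : Matrix (α × Q) (β × Q) ℂ)
    (Y : Matrix (β × Q) (γ × Q) ℂ) : blocks (X * Y) = blocks X * blocks Y := by
  ext a b i j
  simp [Matrix.mul_apply, Matrix.sum_apply, Fintype.sum_prod_type]

theorem blocks_one [DecidableEq α] [DecidableEq Q] :
    blocks (1 : Matrix (α × Q) (α × Q) ℂ) = 1 := by
  ext a b i j
  by_cases h : a = b <;> simp [Matrix.one_apply, h]

theorem blocks_kronecker_one [Fintype Q] [DecidableEq Q] (M : Matrix α β ℂ) :
    blocks (M ⊗ₖ (1 : Matrix Q Q ℂ)) = scal (Matrix Q Q ℂ) M := by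
  ext a b i j
  simp [Matrix.algebraMap_matrix_apply, Matrix.one_apply]

theorem blocks_list_prod [Fintype α] [DecidableEq α] [Fintype Q] [DecidableEq Q]
    (L : List (Matrix (α × Q) (α × Q) ℂ)) : blocks L.prod = (L.map blocks).prod := by
  induction L with
  | nil => simp [blocks_one]
  | cons X L ih => simp [blocks_mul, ih]

/-- This makes fusion an identity between matrices over the operator algebra of the third space: the
Kronecker product multiplies the entries there in the right order. -/
theorem blocks_emb13_mul_emb23 {l m : ℕ} (A : Matrix (Idx l × Idx m) (Idx l × Idx m) ℂ)
    (B : Matrix (Idx 1 × Idx m) (Idx 1 × Idx m) ℂ) :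
    blocks (emb13 A * emb23 l B) = blocks A ⊗ₖ blocks B := by
  ext ⟨a, b⟩ ⟨a', b'⟩ i i'
  simp only [blocks_apply, Matrix.mul_apply, emb13, emb23, Matrix.of_apply,
    Fintype.sum_prod_type, Matrix.kronecker_apply]
  simp [Finset.sum_ite_irrel]

theorem blocks_fuse (lam : ℂ) {l m : ℕ} (A : Matrix (Idx l × Idx m) (Idx l × Idx m) ℂ)
    (B : Matrix (Idx 1 × Idx m) (Idx 1 × Idx m) ℂ) :
    blocks (fuse lam A B) =
      scal (Matrix (Idx m) (Idx m) ℂ) (proj lam l) * (blocks A ⊗ₖ blocks B) *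
        scal (Matrix (Idx m) (Idx m) ℂ) (incl lam l) := by
  rw [fuse, blocks_mul, blocks_mul, blocks_kronecker_one, blocks_kronecker_one,
    blocks_emb13_mul_emb23]

@[simp] theorem flip_apply {m l : ℕ} (A : Matrix (Idx m × Idx l) (Idx m × Idx l) ℂ)
    (p q : Idx l × Idx m) : flip A p q = A (p.2, p.1) (q.2, q.1) := rfl

@[simp] theorem flip_flip {m l : ℕ} (A : Matrix (Idx m × Idx l) (Idx m × Idx l) ℂ) :
    flip (flip A) = A := rfl

theorem flip_smul {m l : ℕ} (c : ℂ) (A : Matrix (Idx m × Idx l) (Idx m × Idx l) ℂ) :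
    flip (c • A) = c • flip A := rfl

end Blocks

/-! ### Embeddings of the operators on one tensor factor -/

section Sites

variable {α β : Type*} [Fintype α] [DecidableEq α] [Fintype β] [DecidableEq β]

/-- The embedding `X ↦ X ⊗ 1`. -/
def leftFactor (α β : Type*) [Fintype α] [DecidableEq α] [Fintype β] [DecidableEq β] :
    Matrix α α ℂ →ₐ[ℂ] Matrix (α × β) (α × β) ℂ :=
  AlgHom.ofLinearMap
    { toFun := fun X => X ⊗ₖ 1
      map_add' := fun X Y => Matrix.add_kronecker X Y 1
      map_smul' := fun c X => Matrix.smul_kronecker c X 1 }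
    Matrix.one_kronecker_one
    (fun X Y => by simpa using Matrix.mul_kronecker_mul X Y (1 : Matrix β β ℂ) 1)

/-- The embedding `Y ↦ 1 ⊗ Y`. -/
def rightFactor (α β : Type*) [Fintype α] [DecidableEq α] [Fintype β] [DecidableEq β] :
    Matrix β β ℂ →ₐ[ℂ] Matrix (α × β) (α × β) ℂ :=
  AlgHom.ofLinearMap
    { toFun := fun X => 1 ⊗ₖ X
      map_add' := fun X Y => Matrix.kronecker_add 1 X Y
      map_smul' := fun c X => Matrix.kronecker_smul c 1 X }
    Matrix.one_kronecker_one
    (fun X Y => by simpa using Matrix.mul_kronecker_mul (1 : Matrix α α ℂ) 1 X Y)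

theorem leftFactor_apply (X : Matrix α α ℂ) : leftFactor α β X = X ⊗ₖ 1 := rfl

theorem rightFactor_apply (Y : Matrix β β ℂ) : rightFactor α β Y = 1 ⊗ₖ Y := rfl

theorem leftFactor_mul_rightFactor (X : Matrix α α ℂ) (Y : Matrix β β ℂ) :
    leftFactor α β X * rightFactor α β Y = X ⊗ₖ Y := by
  rw [leftFactor_apply, rightFactor_apply, ← Matrix.mul_kronecker_mul, mul_one, one_mul]

theorem commute_rightFactor_leftFactor (X : Matrix α α ℂ) (Y : Matrix β β ℂ) :
    Commute (rightFactor α β Y) (leftFactor α β X) := by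
  rw [Commute, SemiconjBy, leftFactor_mul_rightFactor, leftFactor_apply, rightFactor_apply,
    ← Matrix.mul_kronecker_mul, mul_one, one_mul]

open scoped Classical in
/-- The operator acting as `X` on the `k`-th of `N` sites. -/
def siteFun (N : ℕ) (k : Fin N) (X : Matrix α α ℂ) : Matrix (Fin N → α) (Fin N → α) ℂ :=
  Matrix.of fun x y => if ∀ i, i ≠ k → x i = y i then X (x k) (y k) else 0

theorem siteFun_mul_apply (N : ℕ) (k : Fin N) (X : Matrix α α ℂ)
    (M : Matrix (Fin N → α) (Fin N → α) ℂ) (x y : Fin N → α) :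
    (siteFun N k X * M) x y = ∑ j, X (x k) j * M (Function.update x k j) y := by
  rw [Matrix.mul_apply]
  symm
  refine Fintype.sum_of_injective (Function.update x k) (Function.update_injective x k) _ _ ?_ ?_
  · intro z hz
    have : ¬ ∀ i, i ≠ k → x i = z i := by
      intro h
      refine hz ⟨z k, ?_⟩
      ext i
      by_cases hi : i = k
      · subst hi; simp
      · simp [hi, h i hi]
    simp [siteFun, this]
  · intro j
    simp +contextual [siteFun]

theorem siteFun_mul (N : ℕ) (k : Fin N) (X Y : Matrix α α ℂ) :
    siteFun N k (X * Y) = siteFun N k X * siteFun N k Y := by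
  ext x y
  rw [siteFun_mul_apply]
  by_cases h : ∀ i, i ≠ k → x i = y i
  · simp +contextual [siteFun, Matrix.mul_apply, h]
  · have : ∀ j, ¬ ∀ i, i ≠ k → Function.update x k j i = y i := by
      intro j hj
      exact h fun i hi => by simpa [hi] using hj i hi
    simp only [siteFun, Matrix.of_apply, h, this, if_false, mul_zero, Finset.sum_const_zero]

/-- The embedding of the operators on the `k`-th of `N` sites. -/
def site (α : Type*) [Fintype α] [DecidableEq α] (N : ℕ) (k : Fin N) :
    Matrix α α ℂ →ₐ[ℂ] Matrix (Fin N → α) (Fin N → α) ℂ :=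
  AlgHom.ofLinearMap
    { toFun := siteFun N k
      map_add' := fun X Y => by
        ext x y
        simp only [siteFun, Matrix.of_apply, Matrix.add_apply]
        split_ifs <;> simp
      map_smul' := fun c X => by
        ext x y
        simp only [siteFun, Matrix.of_apply, Matrix.smul_apply, RingHom.id_apply]
        split_ifs <;> simp }
    (by
      ext x y
      by_cases h : x = y
      · subst h
        simp [siteFun]
      · have : (∀ i, i ≠ k → x i = y i) → x k ≠ y k := by
          intro h1 h2
          refine h (funext fun i => ?_)
          by_cases hi : i = k
          · rw [hi, h2]
          · exact h1 i hi
        simp only [LinearMap.coe_mk, AddHom.coe_mk, siteFun, Matrix.of_apply, Matrix.one_apply, h,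
          if_false]
        split_ifs with h1 h2
        · exact absurd h2 (this h1)
        · rfl
        · rfl)
    (siteFun_mul N k)

theorem site_commute (N : ℕ) {j k : Fin N} (hjk : j ≠ k) (X Y : Matrix α α ℂ) :
    Commute (site α N j X) (site α N k Y) := by
  -- The entries of the product have a form symmetric under exchange of the two sites.
  have key : ∀ {j k : Fin N}, j ≠ k → ∀ (X Y : Matrix α α ℂ) (x y : Fin N → α),
      (siteFun N j X * siteFun N k Y) x y =
        if ∀ i, i ≠ j → i ≠ k → x i = y i then X (x j) (y j) * Y (x k) (y k) else 0 := by
    intro j k hjk X Y x y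
    rw [siteFun_mul_apply, Finset.sum_eq_single (y j)]
    · have : (∀ i, i ≠ k → Function.update x j (y j) i = y i) ↔
          ∀ i, i ≠ j → i ≠ k → x i = y i := by
        refine forall_congr' fun i => ?_
        by_cases hi : i = j
        · subst hi; simp
        · simp [hi]
      simp only [siteFun, Matrix.of_apply, this, Function.update_of_ne hjk.symm]
      split_ifs <;> simp
    · intro b _ hb
      have : ¬ ∀ i, i ≠ k → Function.update x j b i = y i := by
        intro h
        exact hb (by simpa using h j hjk)
      simp only [siteFun, Matrix.of_apply, this, if_false, mul_zero]
    · simp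
  change siteFun N j X * siteFun N k Y = siteFun N k Y * siteFun N j X
  ext x y
  rw [key hjk, key hjk.symm, mul_comm]
  congr 1
  exact propext ⟨fun h i hk hj => h i hj hk, fun h i hj hk => h i hk hj⟩

end Sites

/-! ### Entries of the R-matrix and of the fusion maps -/

/-- The addition formula behind both the fusion identity for entries and the quantum determinant. -/
theorem sinh_mul_sinh_sub (x a b : ℂ) :
    sinh (x + a) * sinh (x + b) - sinh a * sinh b = sinh x * sinh (x + a + b) := by
  simp only [Complex.sinh_add, Complex.cosh_add]
  linear_combination (sinh a * sinh b) * Complex.cosh_sq x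

theorem root_mul_self (lam : ℂ) (j : ℕ) : root lam j * root lam j = sinh (j * lam) := by
  rw [root, ← pow_two, Complex.sqrt]
  exact Complex.cpow_nat_inv_pow _ two_ne_zero

@[simp] theorem root_zero (lam : ℂ) : root lam 0 = 0 := by simp [root]

/-- The entries of `R^{(l,1)}(u)`, with the labels of the first factor read as natural numbers. -/
def rEntry (lam : ℂ) (l : ℕ) (u : ℂ) (i : ℕ) (c : Idx 1) (j : ℕ) (d : Idx 1) : ℂ :=
  if c = d then
    if i = j then (if c = 0 then sinh (u + ((l : ℂ) - i) * lam) else sinh (u + i * lam)) else 0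
  else if c = 1 then (if i + 1 = j then root lam j * root lam (l + 1 - j) else 0)
  else if j + 1 = i then root lam i * root lam (l + 1 - i) else 0

theorem Rl1_apply {lam : ℂ} (h : sinh lam ≠ 0) (l : ℕ) (u : ℂ) (i : Idx l) (c : Idx 1)
    (j : Idx l) (d : Idx 1) : Rl1 lam l u (i, c) (j, d) = rEntry lam l u i c j d := by
  have h1 : root lam 1 * root lam 1 / sinh lam = 1 := by
    rw [root_mul_self]; simp [h]
  have e0 : u + lam / 2 * ((l : ℂ) + ((l : ℂ) - 2 * (i : ℕ))) = u + ((l : ℂ) - (i : ℕ)) * lam := by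
    ring
  have e1 : u + lam / 2 * ((l : ℂ) + ((l : ℂ) - 2 * (i : ℕ)) * (1 - 2)) = u + (i : ℕ) * lam := by
    ring
  fin_cases c <;> fin_cases d <;>
    simp [Rl1, rEntry, Sp, Sm, sz, f, Matrix.diagonal_apply, h1, e0, e1, Fin.ext_iff] <;>
    field_simp

theorem flip_Rl1_one {lam : ℂ} (h : sinh lam ≠ 0) (u : ℂ) :
    flip (Rl1 lam 1 u) = Rl1 lam 1 u := by
  ext ⟨a, b⟩ ⟨c, d⟩
  rw [flip_apply, Rl1_apply h, Rl1_apply h]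
  fin_cases a <;> fin_cases b <;> fin_cases c <;> fin_cases d <;> simp [rEntry]

/-- Taking `g` on all of ℕ avoids boundary cases: at J = l + 1, which labels no vector of V_l, the
coefficient is `root lam 0` = 0. The same happens at J = 0 for the truncated J - 1 in the next
lemma. -/
theorem sum_proj_zero_mul (lam : ℂ) (l : ℕ) (J : Idx (l + 1)) (g : ℕ → ℂ) :
    ∑ j : Idx l, proj lam l J (j, 0) * g j = root lam (l + 1 - J) * g J := by
  have hJ := J.isLt
  by_cases h : (J : ℕ) < l + 1
  · rw [Finset.sum_eq_single (⟨J, h⟩ : Idx l)]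
    · simp [proj]
    · intro b _ hb
      have : ¬ (J : ℕ) = b := fun e => hb (Fin.ext e.symm)
      simp [proj, this]
    · simp
  · have : l + 1 - (J : ℕ) = 0 := by omega
    rw [this, root_zero, zero_mul]
    refine Finset.sum_eq_zero fun b _ => ?_
    have : ¬ (J : ℕ) = b := by have := b.isLt; omega
    simp [proj, this]

theorem sum_proj_one_mul (lam : ℂ) (l : ℕ) (J : Idx (l + 1)) (g : ℕ → ℂ) :
    ∑ j : Idx l, proj lam l J (j, 1) * g j = root lam J * g (J - 1) := by
  have hJ := J.isLt
  by_cases h : (J : ℕ) = 0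
  · simp [proj, h]
  · rw [Finset.sum_eq_single (⟨J - 1, by omega⟩ : Idx l)]
    · have : (J : ℕ) = J - 1 + 1 := by omega
      simp [proj, ← this]
    · intro b _ hb
      have : ¬ (J : ℕ) = b + 1 := fun e => hb (Fin.ext (by simp [e]))
      simp [proj, this]
    · simp

theorem sum_proj_mul (lam : ℂ) (l : ℕ) (J : Idx (l + 1)) (g : ℕ → Idx 1 → ℂ) :
    ∑ p, proj lam l J p * g p.1 p.2 =
      root lam (l + 1 - J) * g J 0 + root lam J * g (J - 1) 1 := by
  rw [Fintype.sum_prod_type_right, Fin.sum_univ_two]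
  exact congrArg₂ _ (sum_proj_zero_mul lam l J fun n => g n 0)
    (sum_proj_one_mul lam l J fun n => g n 1)

theorem sum_mul_proj_zero (lam : ℂ) (l : ℕ) (j : Idx l) (g : ℕ → ℂ) :
    ∑ J : Idx (l + 1), g J * proj lam l J (j, 0) = g j * root lam (l + 1 - j) := by
  rw [Finset.sum_eq_single j.castSucc]
  · simp [proj]
  · intro b _ hb
    have : ¬ (b : ℕ) = j := fun e => hb (Fin.ext (by simp [e]))
    simp [proj, this]
  · simp

theorem sum_mul_proj_one (lam : ℂ) (l : ℕ) (j : Idx l) (g : ℕ → ℂ) :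
    ∑ J : Idx (l + 1), g J * proj lam l J (j, 1) = g (j + 1) * root lam (j + 1) := by
  rw [Finset.sum_eq_single j.succ]
  · simp [proj]
  · intro b _ hb
    have : ¬ (b : ℕ) = j + 1 := fun e => hb (Fin.ext (by simp [e]))
    simp [proj, this]
  · simp

theorem scal_mul_apply {α β γ Q : Type*} [Fintype β] [Fintype Q] [DecidableEq Q]
    (M : Matrix α β ℂ) (X : Matrix β γ (Matrix Q Q ℂ)) (a : α) (b : γ) (i j : Q) :
    (scal (Matrix Q Q ℂ) M * X) a b i j = ∑ p, M a p * X p b i j := by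
  simp [Matrix.mul_apply, Matrix.sum_apply, Algebra.algebraMap_eq_smul_one]

theorem mul_scal_apply {α β γ Q : Type*} [Fintype β] [Fintype Q] [DecidableEq Q]
    (M : Matrix β γ ℂ) (X : Matrix α β (Matrix Q Q ℂ)) (a : α) (b : γ) (i j : Q) :
    (X * scal (Matrix Q Q ℂ) M) a b i j = ∑ p, X a p i j * M p b := by
  simp [Matrix.mul_apply, Matrix.sum_apply, Algebra.algebraMap_eq_smul_one, mul_comm]

/-- Both sides vanish unless the weight is conserved; each of the eight remaining choices of `b`,
`c`, `c'` is an instance of `sinh_mul_sinh_sub` or trivial. -/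
theorem rEntry_fusion (lam u : ℂ) (j k J : ℕ) (hJ : J ≤ j + k + 1) (b c c' : Idx 1) :
    root lam (j + k + 1 - J) * (rEntry lam (j + k) (u + lam) J c j 0 * rEntry lam 1 u 0 0 b c' +
        rEntry lam (j + k) (u + lam) J c j 1 * rEntry lam 1 u 0 1 b c') +
      root lam J * (rEntry lam (j + k) (u + lam) (J - 1) c j 0 * rEntry lam 1 u 1 0 b c' +
        rEntry lam (j + k) (u + lam) (J - 1) c j 1 * rEntry lam 1 u 1 1 b c') =
    sinh (u + lam) * rEntry lam (j + k + 1) u J c (j + b) c' *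
      (if b = 0 then root lam (k + 1) else root lam (j + 1)) := by
  have h1 : root lam 1 * root lam 1 = sinh lam := by simp [root_mul_self]
  have hA : ∀ n : ℕ, sinh (u + lam) * sinh (u + n * lam) - sinh lam * sinh (n * lam) =
      sinh u * sinh (u + lam + n * lam) := fun n => sinh_mul_sinh_sub u lam (n * lam)
  have hB : ∀ n : ℕ, sinh (u + lam) * (root lam (n + 1) * root lam (n + 1)) -
      sinh u * sinh (n * lam) = sinh lam * sinh (u + lam + n * lam) := by
    intro n
    rw [root_mul_self, ← add_comm lam u, ← sinh_mul_sinh_sub lam u (n * lam)]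
    push_cast
    ring_nf
  have hr := root_mul_self lam
  have e1 : j + k + 1 - j = k + 1 := by omega
  have e3 : j + k + 1 - (j + 1) = k := by omega
  have e4 : j + k + 1 + 1 - (j + 1) = k + 1 := by omega
  have e5 : j + k + 1 + 1 - (j + 2) = k := by omega
  -- At j = 0 the truncated condition fails, but then `root lam j` = 0.
  have e6 : ∀ x : ℂ, (if j - 1 + 1 = j then root lam j * x else 0) = root lam j * x := by
    intro x
    rcases j with _ | j <;> simp
  have e7 : ∀ n : ℕ, u + lam + n * lam = u + (n + 1) * lam := fun n => by ring
  -- Conservation of S^z.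
  by_cases hd : J + c = j + b + c'
  · fin_cases b <;> fin_cases c <;> fin_cases c' <;>
    simp at hd <;>
    simp [rEntry, h1, hd, -mul_eq_mul_left_iff, -mul_eq_mul_right_iff, e1, e3, e4, e5, e6]
    · rw [e7, add_sub_right_comm, add_sub_cancel_left]; ring
    · linear_combination root lam (j + 1) * (sinh u * hr k - hB k)
    · subst hd
      have e8 : J + 1 + k + 1 - J = k + 2 := by omega
      have e9 : J + 1 + k + 1 + 1 - (J + 1) = k + 2 := by omega
      rw [e8, e9]; ring
    · linear_combination root lam (k + 1) * (sinh lam * hr j - hA j)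
    · linear_combination root lam (j + 1) * (sinh lam * hr k - hA k)
    · ring
    · linear_combination root lam (k + 1) * (sinh u * hr j - hB j)
    · rw [e7]; ring
  · fin_cases b <;> fin_cases c <;> fin_cases c' <;>
    simp at hd <;>
    simp [rEntry, h1, -mul_eq_mul_left_iff, -mul_eq_mul_right_iff] <;>
    rcases J with _ | J <;> simp <;> grind

theorem sum_idx_one {M : Type*} [AddCommMonoid M] (g : Idx 1 → M) : ∑ x, g x = g 0 + g 1 :=
  Fin.sum_univ_two g

/-- Fusion against a spin-1/2 third space, with the explicit R-matrix as result; the factor sinh(u +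
λ) is the price of its normalisation. It is the base of the fusion in the quantum space. -/
theorem proj_mul_Rl1 {lam : ℂ} (h : sinh lam ≠ 0) (l : ℕ) (u : ℂ) :
    scal (Matrix (Idx 1) (Idx 1) ℂ) (proj lam l) *
        (blocks (Rl1 lam l (u + lam)) ⊗ₖ blocks (Rl1 lam 1 u)) =
      blocks (sinh (u + lam) • Rl1 lam (l + 1) u) *
        scal (Matrix (Idx 1) (Idx 1) ℂ) (proj lam l) := by
  ext J ⟨j, b⟩ c c'
  let g : ℕ → Idx 1 → ℂ := fun n b' =>
    rEntry lam l (u + lam) n c j 0 * rEntry lam 1 u b' 0 b c' +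
      rEntry lam l (u + lam) n c j 1 * rEntry lam 1 u b' 1 b c'
  let g' : ℕ → ℂ := fun n => sinh (u + lam) * rEntry lam (l + 1) u J c n c'
  have e1 : ∀ p : Idx l × Idx 1, proj lam l J p *
      (blocks (Rl1 lam l (u + lam)) ⊗ₖ blocks (Rl1 lam 1 u)) p (j, b) c c' =
      proj lam l J p * g p.1 p.2 := by
    intro p
    simp only [Matrix.kroneckerMap_apply, Matrix.mul_apply, sum_idx_one, blocks_apply,
      Rl1_apply h, g]
  have e2 : ∀ J' : Idx (l + 1), blocks (sinh (u + lam) • Rl1 lam (l + 1) u) J J' c c' *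
      proj lam l J' (j, b) = g' J' * proj lam l J' (j, b) := by
    intro J'
    simp [g', Rl1_apply h]
  rw [scal_mul_apply, mul_scal_apply]
  refine ((Finset.sum_congr rfl fun p _ => e1 p).trans (sum_proj_mul lam l J g)).trans ?_
  refine Eq.trans ?_ (Finset.sum_congr rfl fun p _ => e2 p).symm
  obtain ⟨k, hk⟩ : ∃ k, l = j + k := ⟨l - j, by omega⟩
  have key := rEntry_fusion lam u j k J (by omega) b c c'
  rw [← hk] at key
  have e3 : l + 1 - (j : ℕ) = k + 1 := by omega
  have hb : b = 0 ∨ b = 1 := by fin_cases b <;> simp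
  rcases hb with rfl | rfl
  · refine Eq.trans key (Eq.trans ?_ (sum_mul_proj_zero lam l j g').symm)
    simp [g', e3]
  · refine Eq.trans key (Eq.trans ?_ (sum_mul_proj_one lam l j g').symm)
    simp [g']

/-- The antisymmetric form on `V_1`. -/
def eps (d b : Idx 1) : ℂ := if d = b then 0 else if d = 0 then 1 else -1

theorem sum_rEntry_mul (lam : ℂ) (m : ℕ) (u : ℂ) (i : Idx m) (c d : Idx 1) (g : ℕ → ℂ) :
    ∑ k : Idx m, rEntry lam m u i c k d * g k =
      if c = d then (if c = 0 then sinh (u + ((m : ℂ) - (i : ℕ)) * lam)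
        else sinh (u + (i : ℕ) * lam)) * g i
      else if c = 1 then root lam (i + 1) * root lam (m - i) * g (i + 1)
      else root lam i * root lam (m + 1 - i) * g (i - 1) := by
  have hi := i.isLt
  by_cases hcd : c = d
  · simp only [rEntry, hcd, if_true]
    rw [Finset.sum_eq_single i]
    · simp
    · intro b _ hb
      have : ¬ (i : ℕ) = b := fun e => hb (Fin.ext e.symm)
      simp [this]
    · simp
  · by_cases hc : c = 1
    · simp only [rEntry, hc, if_true, if_false, show ¬ 1 = d from fun e => hcd (hc.trans e)]
      by_cases him : (i : ℕ) + 1 < m + 1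
      · rw [Finset.sum_eq_single (⟨i + 1, him⟩ : Idx m)]
        · simp
        · intro b _ hb
          have : ¬ (i : ℕ) + 1 = b := fun e => hb (Fin.ext e.symm)
          simp [this]
        · simp
      · have : m - (i : ℕ) = 0 := by omega
        rw [this, root_zero, mul_zero, zero_mul]
        refine Finset.sum_eq_zero fun b _ => ?_
        have : ¬ (i : ℕ) + 1 = b := by have := b.isLt; omega
        simp [this]
    · simp only [rEntry, hcd, hc, if_false]
      by_cases him : (i : ℕ) = 0
      · simp [him]
      · rw [Finset.sum_eq_single (⟨i - 1, by omega⟩ : Idx m)]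
        · have : (i : ℕ) - 1 + 1 = i := by omega
          simp [this]
        · intro b _ hb
          have : ¬ (b : ℕ) + 1 = i := fun e => hb (Fin.ext (by simp [← e]))
          simp [this]
        · simp

/-- The quantum determinant of `R^{(1,m)}`. -/
theorem quantum_det {lam : ℂ} (h : sinh lam ≠ 0) (m : ℕ) (u : ℂ) (d b : Idx 1) :
    blocks (flip (Rl1 lam m (u + lam))) d 0 * blocks (flip (Rl1 lam m u)) b 1 -
        blocks (flip (Rl1 lam m (u + lam))) d 1 * blocks (flip (Rl1 lam m u)) b 0 =
      algebraMap ℂ (Matrix (Idx m) (Idx m) ℂ)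
        (sinh u * sinh (u + (m + 1) * lam) * eps d b) := by
  ext i j
  have hi := i.isLt
  obtain ⟨k, hk⟩ : ∃ k, m = i + k := ⟨m - i, by omega⟩
  have hmul : ∀ c d c' d' : Idx 1, (blocks (flip (Rl1 lam m (u + lam))) c d *
      blocks (flip (Rl1 lam m u)) c' d') i j =
      ∑ k : Idx m, rEntry lam m (u + lam) i c k d * rEntry lam m u k c' j d' := by
    intro c d c' d'
    simp only [Matrix.mul_apply, blocks_apply, flip_apply, Rl1_apply h]
  -- Both diagonal cases reduce to this, with (n, n') equal to (i, k + 1) or (i + 1, k).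
  have hdet : ∀ n n' : ℕ, n + n' = m + 1 →
      sinh (u + n * lam) * sinh (u + n' * lam) -
        root lam n * root lam n * (root lam n' * root lam n') =
      sinh u * sinh (u + (m + 1) * lam) := by
    intro n n' hn
    have hn' : (m : ℂ) + 1 = n + n' := by exact_mod_cast hn.symm
    rw [root_mul_self, root_mul_self, sinh_mul_sinh_sub, hn', add_mul, add_assoc]
  have hs : ∀ c d c' d', ∑ k : Idx m, rEntry lam m (u + lam) i c k d *
      rEntry lam m u k c' j d' = _ := fun c d c' d' =>
    sum_rEntry_mul lam m (u + lam) i c d (fun n => rEntry lam m u n c' j d')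
  rw [Matrix.sub_apply, hmul, hmul, hs, hs, Matrix.algebraMap_matrix_apply]
  have hij : i = j ↔ (i : ℕ) = j := Fin.ext_iff
  have k1 : m - (i : ℕ) = k := by omega
  have k2 : m + 1 - (i : ℕ) = k + 1 := by omega
  have k3 : m + 1 - ((i : ℕ) + 1) = k := by omega
  have k4 : (m : ℂ) - (i : ℕ) = k := by
    rw [sub_eq_iff_eq_add]
    exact_mod_cast hk.trans (add_comm _ _)
  simp only [hij]
  clear hs hmul
  fin_cases d <;> fin_cases b <;> simp [eps, rEntry, k1, k2, k3, k4]
  · by_cases hi0 : (i : ℕ) = 0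
    · simp [hi0]
    · by_cases hij' : (j : ℕ) + 1 = i
      · have e1 : (i : ℕ) - 1 = j := by omega
        have e2 : (m : ℂ) - (j : ℕ) = k + 1 := by
          rw [← k4, ← hij']
          push_cast
          ring
        rw [if_pos hij', if_pos e1, e1, e2, add_mul, one_mul, add_assoc, add_comm lam]
        ring
      · have e1 : ¬ (i : ℕ) - 1 = j := by omega
        simp [hij', e1]
  · by_cases hij' : (i : ℕ) = j
    · have e1 : (if (i : ℕ) - 1 + 1 = j then
          root lam i * root lam (k + 1) * (root lam j * root lam (m + 1 - j)) else 0) =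
          root lam i * root lam i * (root lam (k + 1) * root lam (k + 1)) := by
        rw [← hij', k2]
        by_cases hi0 : (i : ℕ) = 0
        · simp [hi0]
        · rw [if_pos (by omega)]
          ring
      rw [e1, if_pos hij', if_pos hij', ← hdet i (k + 1) (by omega)]
      push_cast
      ring_nf
    · have e1 : (if (i : ℕ) - 1 + 1 = j then
          root lam i * root lam (k + 1) * (root lam j * root lam (m + 1 - j)) else 0) = 0 := by
        by_cases hi0 : (i : ℕ) = 0
        · simp [hi0]
        · rw [if_neg (by omega)]
      rw [e1, if_neg hij', if_neg hij', sub_zero]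
  · by_cases hij' : (i : ℕ) = j
    · rw [if_pos hij'.symm, if_pos hij', if_pos hij', ← hdet (i + 1) k (by omega)]
      push_cast
      ring_nf
    · rw [if_neg (Ne.symm hij'), if_neg hij', if_neg hij', sub_zero]
  · by_cases hij' : (i : ℕ) + 1 = j
    · rw [if_pos hij', if_pos hij', ← hij', k3]
      ring_nf
    · simp [hij']

/-! ### The singlet component of `V_{l+1} ⊗ V_1` -/

/-- The embedding of the singlet component `V_l` into `V_{l+1} ⊗ V_1`. Its image is the kernel
of `proj lam (l + 1)`. -/
def sing (lam : ℂ) (l : ℕ) : Matrix (Idx (l + 1) × Idx 1) (Idx l) ℂ :=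
  Matrix.of fun p j => if p.2 = 0 then -proj lam l p.1 (j, 1) else proj lam l p.1 (j, 0)

/-- The left inverse of `sing` that vanishes on the image of `incl`. -/
def cosing (lam : ℂ) (l : ℕ) : Matrix (Idx l) (Idx (l + 1) × Idx 1) ℂ :=
  Matrix.of fun j p =>
    if p.2 = 0 then
      if (p.1 : ℕ) = j + 1 then
        -(Complex.exp (-(((l + 1 - j : ℕ) : ℂ) * lam)) * root lam (j + 1)) /
          sinh (((l + 2 : ℕ) : ℂ) * lam) else 0
    else if (p.1 : ℕ) = j then
        Complex.exp (((j + 1 : ℕ) : ℂ) * lam) * root lam (l + 1 - j) /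
          sinh (((l + 2 : ℕ) : ℂ) * lam) else 0

/-- This explains the exponential weights in `incl` and `cosing`: they make the two squared
coefficients of `proj` add up to a constant. -/
theorem exp_mul_sinh_add (x y : ℂ) :
    Complex.exp x * sinh y + Complex.exp (-y) * sinh x = sinh (x + y) := by
  simp only [Complex.sinh, neg_add, Complex.exp_add]
  ring

theorem exp_mul_root_add (lam : ℂ) {n J : ℕ} (hJ : J ≤ n) :
    Complex.exp (J * lam) * (root lam (n - J) * root lam (n - J)) +
      Complex.exp (-((n - J : ℕ) * lam)) * (root lam J * root lam J) = sinh (n * lam) := by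
  rw [root_mul_self, root_mul_self, exp_mul_sinh_add, ← add_mul]
  congr 2
  exact_mod_cast Nat.add_sub_of_le hJ

theorem proj_mul_incl {lam : ℂ} {l : ℕ} (h : sinh ((l + 1 : ℕ) * lam) ≠ 0) :
    proj lam l * incl lam l = 1 := by
  ext J J'
  have hJ := J.isLt
  let g : ℕ → Idx 1 → ℂ := fun a b => if (J' : ℕ) = a + b then
      (if b = 0 then Complex.exp (((J' : ℕ) : ℂ) * lam) * root lam (l + 1 - (J' : ℕ))
        else Complex.exp (-(((l + 1 - (J' : ℕ) : ℕ) : ℂ) * lam)) * root lam (J' : ℕ))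
        / Complex.sinh (((l + 1 : ℕ) : ℂ) * lam)
    else 0
  have key := exp_mul_root_add lam (show (J : ℕ) ≤ l + 1 by omega)
  refine (sum_proj_mul lam l J g).trans ?_
  by_cases hJJ : J = J'
  · subst hJJ
    have : root lam J * g (J - 1) 1 = root lam J *
        (Complex.exp (-(((l + 1 - (J : ℕ) : ℕ) : ℂ) * lam)) * root lam (J : ℕ)
          / Complex.sinh (((l + 1 : ℕ) : ℂ) * lam)) := by
      by_cases h0 : (J : ℕ) = 0
      · simp [h0]
      · have : (J : ℕ) = J - 1 + 1 := by omega
        simp [g, ← this]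
    rw [this]
    simp only [g, Matrix.one_apply_eq]
    simp only [Fin.val_zero, add_zero, if_true]
    rw [← mul_div_assoc, ← mul_div_assoc, ← add_div, div_eq_one_iff_eq h]
    linear_combination key
  · have h1 : ¬ (J' : ℕ) = J := fun e => hJJ (Fin.ext e.symm)
    have h2 : root lam J * g (J - 1) 1 = 0 := by
      by_cases h0 : (J : ℕ) = 0
      · simp [h0]
      · have : ¬ (J' : ℕ) = J - 1 + 1 := by omega
        simp [g, this]
    rw [h2, Matrix.one_apply_ne hJJ]
    simp [g, h1]

/-- The two components of a singlet vector are sent to the same basis vector, with the same product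
of roots and opposite signs. -/
theorem proj_mul_sing (lam : ℂ) (l : ℕ) : proj lam (l + 1) * sing lam l = 0 := by
  ext J j
  let g : ℕ → Idx 1 → ℂ := fun a b => if b = 0 then
      -(if a = (j : ℕ) + 1 then root lam a else 0)
    else if a = j then root lam (l + 1 - j) else 0
  have e : ∀ p : Idx (l + 1) × Idx 1, proj lam (l + 1) J p * sing lam l p j =
      proj lam (l + 1) J p * g p.1 p.2 := by
    rintro ⟨a, b⟩
    have hb : b = 0 ∨ b = 1 := by fin_cases b <;> simp
    rcases hb with rfl | rfl
    · simp [sing, g, proj]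
    · by_cases h : (a : ℕ) = j <;> simp [sing, g, proj, h]
  refine ((Finset.sum_congr rfl fun p _ => e p).trans (sum_proj_mul lam (l + 1) J g)).trans ?_
  by_cases h0 : (J : ℕ) = 0
  · simp [g, h0]
  · by_cases h : (J : ℕ) = j + 1
    · simp [g, h]
      ring
    · have : ¬ (J : ℕ) - 1 = j := by omega
      simp [g, h, this]

theorem cosing_mul_sing {lam : ℂ} {l : ℕ} (h : sinh ((l + 2 : ℕ) * lam) ≠ 0) :
    cosing lam l * sing lam l = 1 := by
  ext j j'
  let g : ℕ → Idx 1 → ℂ := fun a b => if b = 0 then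
      if a = (j : ℕ) + 1 then
        -(Complex.exp (-(((l + 1 - j : ℕ) : ℂ) * lam)) * root lam (j + 1)) /
          sinh (((l + 2 : ℕ) : ℂ) * lam) else 0
    else if a = j then
        Complex.exp (((j + 1 : ℕ) : ℂ) * lam) * root lam (l + 1 - j) /
          sinh (((l + 2 : ℕ) : ℂ) * lam) else 0
  have hj := j.isLt
  have key := exp_mul_root_add lam (show (j : ℕ) + 1 ≤ l + 2 by omega)
  rw [show l + 2 - ((j : ℕ) + 1) = l + 1 - j by omega] at key
  have e : (cosing lam l * sing lam l) j j' =
      -(g (j' + 1) 0 * root lam (j' + 1)) + g j' 1 * root lam (l + 1 - j') := by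
    rw [Matrix.mul_apply, Fintype.sum_prod_type_right, sum_idx_one,
      ← sum_mul_proj_one lam l j' (fun n => g n 0), ← sum_mul_proj_zero lam l j' (fun n => g n 1),
      ← Finset.sum_neg_distrib]
    refine congrArg₂ _ (Finset.sum_congr rfl fun a _ => ?_) (Finset.sum_congr rfl fun a _ => ?_)
    · simp [cosing, sing, g]
    · simp [cosing, sing, g]
  rw [e]
  by_cases hjj : j = j'
  · subst hjj
    simp only [g, Matrix.one_apply_eq, if_true, one_ne_zero, if_false]
    rw [← mul_div_right_comm, ← mul_div_right_comm, ← neg_div, ← add_div, div_eq_one_iff_eq h]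
    linear_combination key
  · have h1 : ¬ (j' : ℕ) = j := fun e => hjj (Fin.ext e.symm)
    simp [g, h1, Matrix.one_apply_ne hjj]

/-- The resolution of the identity that splits the trace. Diagonal entries are `exp_mul_root_add`;
off-diagonal ones cancel. -/
theorem incl_mul_proj_add {lam : ℂ} {l : ℕ} (h : sinh ((l + 2 : ℕ) * lam) ≠ 0) :
    incl lam (l + 1) * proj lam (l + 1) + sing lam l * cosing lam l = 1 := by
  ext ⟨a, b⟩ ⟨a', b'⟩
  have ha := a.isLt
  have ha' := a'.isLt
  let E : ℕ → ℂ := fun n => Complex.exp (n * lam)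
  let E' : ℕ → ℂ := fun n => Complex.exp (-(n * lam))
  let S : ℂ := sinh (((l + 2 : ℕ) : ℂ) * lam)
  let g : ℕ → ℂ := fun J => if J = (a : ℕ) + b then
      (if b = 0 then E J * root lam (l + 2 - J) else E' (l + 2 - J) * root lam J) / S
    else 0
  let g' : ℕ → ℂ := fun j => if b' = 0 then
      if (a' : ℕ) = j + 1 then -(E' (l + 1 - j) * root lam (j + 1)) / S else 0
    else if (a' : ℕ) = j then E (j + 1) * root lam (l + 1 - j) / S else 0
  have key : ∀ J ≤ l + 2, E J * (root lam (l + 2 - J) * root lam (l + 2 - J)) +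
      E' (l + 2 - J) * (root lam J * root lam J) = S := fun J hJ => exp_mul_root_add lam hJ
  have e1 : (incl lam (l + 1) * proj lam (l + 1)) (a, b) (a', b') =
      if b' = 0 then g a' * root lam (l + 2 - a') else g (a' + 1) * root lam (a' + 1) := by
    have hb' : b' = 0 ∨ b' = 1 := by fin_cases b' <;> simp
    rcases hb' with rfl | rfl
    · exact sum_mul_proj_zero lam (l + 1) a' g
    · exact sum_mul_proj_one lam (l + 1) a' g
  have e2 : (sing lam l * cosing lam l) (a, b) (a', b') =
      if b = 0 then -(root lam a * g' (a - 1)) else root lam (l + 1 - a) * g' a := by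
    have hb : b = 0 ∨ b = 1 := by fin_cases b <;> simp
    rcases hb with rfl | rfl
    · rw [if_pos rfl, ← sum_proj_one_mul lam l a g', Matrix.mul_apply, ← Finset.sum_neg_distrib]
      refine Finset.sum_congr rfl fun j _ => ?_
      simp only [sing, cosing, Matrix.of_apply, if_true, g', neg_mul, E, E', S]
    · rw [if_neg one_ne_zero, ← sum_proj_zero_mul lam l a g', Matrix.mul_apply]
      refine Finset.sum_congr rfl fun j _ => ?_
      simp only [sing, cosing, Matrix.of_apply, if_neg (one_ne_zero : (1 : Idx 1) ≠ 0), g', E, E',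
        S]
  rw [Matrix.add_apply, e1, e2]
  clear e1 e2
  have haa : a = a' ↔ (a : ℕ) = a' := Fin.ext_iff
  have hS : S ≠ 0 := h
  clear_value E E' S
  simp only [Matrix.one_apply, Prod.mk.injEq, haa, g, g']
  clear haa g g'
  generalize (a : ℕ) = x at *
  generalize (a' : ℕ) = y at *
  have key0 := key x (by omega)
  have key1 := key (x + 1) (by omega)
  rw [show l + 2 - (x + 1) = l + 1 - x by omega] at key1
  fin_cases b <;> fin_cases b' <;> simp
  · rcases x with _ | x
    · by_cases hy : y = 0
      · subst hy
        simp at key0 ⊢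
        field_simp
        linear_combination key0
      · simp [hy, Ne.symm hy]
    · by_cases hy : y = x + 1
      · subst hy
        rw [show l + 2 - (x + 1) = l + 1 - x by omega] at *
        simp
        field_simp
        linear_combination key0
      · simp [hy, Ne.symm hy]
  · rcases x with _ | x
    · simp
    · by_cases hy : y = x
      · subst hy
        simp
        ring
      · simp [hy]
  · by_cases hy : y = x + 1
    · subst hy
      rw [show l + 2 - (x + 1) = l + 1 - x by omega]
      simp
      ring
    · simp [hy]
  · by_cases hy : y = x
    · subst hy
      simp
      field_simp
      linear_combination key1
    · simp [hy, Ne.symm hy]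

/-- Reversing all labels exchanges the two coefficients of `proj`. -/
theorem proj_mul_F (lam : ℂ) (l : ℕ) : proj lam l * (F l ⊗ₖ F 1) = F (l + 1) * proj lam l := by
  ext J ⟨a, b⟩
  have hJ := J.isLt
  have ha := a.isLt
  let g : ℕ → Idx 1 → ℂ := fun a' b' =>
    (if a' + (a : ℕ) = l then 1 else 0) * if (b' : ℕ) + b = 1 then 1 else 0
  let g' : ℕ → ℂ := fun J' => if (J : ℕ) + J' = l + 1 then 1 else 0
  have e : (F (l + 1) * proj lam l) J (a, b) =
      if b = 0 then g' a * root lam (l + 1 - a) else g' (a + 1) * root lam (a + 1) := by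
    have hb : b = 0 ∨ b = 1 := by fin_cases b <;> simp
    rcases hb with rfl | rfl
    · exact sum_mul_proj_zero lam l a g'
    · exact sum_mul_proj_one lam l a g'
  refine (sum_proj_mul lam l J g).trans (Eq.trans ?_ e.symm)
  simp only [g, g']
  generalize (J : ℕ) = x at *
  generalize (a : ℕ) = y at *
  fin_cases b <;> simp
  · rcases x with _ | x
    · have : ¬ y = l + 1 := by omega
      simp [this]
    · by_cases hy : x + y = l
      · have : l + 1 - y = x + 1 := by omega
        simp [hy, this, show x + 1 + y = l + 1 by omega]
      · simp [hy, show ¬ x + 1 + y = l + 1 by omega]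
  · by_cases hy : x + y = l
    · have : l + 1 - x = y + 1 := by omega
      simp [hy, this, show x + (y + 1) = l + 1 by omega]
    · simp [hy, show ¬ x + (y + 1) = l + 1 by omega]

/-- Reversal also exchanges the two terms of the antisymmetric vector. This is the source of the
minus sign in the functional relation. -/
theorem F_mul_sing (lam : ℂ) (l : ℕ) : (F (l + 1) ⊗ₖ F 1) * sing lam l = -(sing lam l * F l) := by
  ext ⟨a, b⟩ j
  have ha := a.isLt
  let g : ℕ → ℂ := fun a' => if (a : ℕ) + a' = l + 1 then 1 else 0
  let g' : ℕ → ℂ := fun j' => if j' + (j : ℕ) = l then 1 else 0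
  have e1 : ((F (l + 1) ⊗ₖ F 1) * sing lam l) (a, b) j =
      -(F 1 b 0 * (g (j + 1) * root lam (j + 1))) + F 1 b 1 * (g j * root lam (l + 1 - j)) := by
    rw [Matrix.mul_apply, Fintype.sum_prod_type_right, sum_idx_one, ← sum_mul_proj_one lam l j g,
      ← sum_mul_proj_zero lam l j g, Finset.mul_sum, Finset.mul_sum, ← Finset.sum_neg_distrib]
    refine congrArg₂ _ (Finset.sum_congr rfl fun a _ => ?_) (Finset.sum_congr rfl fun a _ => ?_)
    · simp only [Matrix.kroneckerMap_apply, sing, Matrix.of_apply, if_true, g, F]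
      ring
    · simp only [Matrix.kroneckerMap_apply, sing, Matrix.of_apply, one_ne_zero, if_false, g, F]
      ring
  have e2 : (sing lam l * F l) (a, b) j =
      if b = 0 then -(root lam a * g' (a - 1)) else root lam (l + 1 - a) * g' a := by
    have hb : b = 0 ∨ b = 1 := by fin_cases b <;> simp
    rcases hb with rfl | rfl
    · rw [if_pos rfl, ← sum_proj_one_mul lam l a g', Matrix.mul_apply, ← Finset.sum_neg_distrib]
      refine Finset.sum_congr rfl fun j _ => ?_
      simp only [sing, F, Matrix.of_apply, if_true, g', neg_mul]
    · rw [if_neg one_ne_zero, ← sum_proj_zero_mul lam l a g', Matrix.mul_apply]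
      refine Finset.sum_congr rfl fun j _ => ?_
      simp only [sing, F, Matrix.of_apply, if_neg (one_ne_zero : (1 : Idx 1) ≠ 0), g']
  rw [Matrix.neg_apply, e1, e2]
  have hj := j.isLt
  simp only [g, g', F, Matrix.of_apply]
  generalize (a : ℕ) = x at *
  generalize (j : ℕ) = y at *
  fin_cases b <;> simp
  · rcases x with _ | x
    · have : ¬ y = l + 1 := by omega
      simp [this]
    · by_cases hy : x + y = l
      · have : l + 1 - y = x + 1 := by omega
        simp [hy, this, show x + 1 + y = l + 1 by omega]
      · simp [hy, show ¬ x + 1 + y = l + 1 by omega]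
  · by_cases hy : x + y = l
    · have : l + 1 - x = y + 1 := by omega
      simp [hy, this, show x + (y + 1) = l + 1 by omega]
    · simp [hy, show ¬ x + (y + 1) = l + 1 by omega]

/-- `sing` is `proj` contracted with `eps`. So `A` can be moved through `proj` by `h`, leaving `G`
times an antisymmetrised product of `L` and `B`, which `hq` declares scalar. -/
theorem mul_sing_of_intertwine {𝒜 : Type*} [Ring 𝒜] [Algebra ℂ 𝒜] (lam q : ℂ) (n : ℕ)
    (G : Matrix (Idx n) (Idx n) 𝒜) (A : Matrix (Idx (n + 1)) (Idx (n + 1)) 𝒜)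
    (L B : Matrix (Idx 1) (Idx 1) 𝒜)
    (h : scal 𝒜 (proj lam n) * (G ⊗ₖ L) = A * scal 𝒜 (proj lam n))
    (hq : ∀ d b, L d 0 * B b 1 - L d 1 * B b 0 = algebraMap ℂ 𝒜 (q * eps d b)) :
    (A ⊗ₖ B) * scal 𝒜 (sing lam n) = q • (scal 𝒜 (sing lam n) * G) := by
  ext ⟨a, b⟩ j
  have hX : ∀ c, ∑ a', A a a' * algebraMap ℂ 𝒜 (proj lam n a' (j, c)) =
      ∑ i, ∑ d, proj lam n a (i, d) • (G i j * L d c) := by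
    intro c
    have := congrFun (congrFun h a) (j, c)
    simp only [Matrix.mul_apply, scal_apply, Fintype.sum_prod_type, Matrix.kroneckerMap_apply,
      ← Algebra.smul_def] at this
    exact this.symm
  have e1 : ((A ⊗ₖ B) * scal 𝒜 (sing lam n)) (a, b) j =
      (∑ a', A a a' * algebraMap ℂ 𝒜 (proj lam n a' (j, 0))) * B b 1 -
        (∑ a', A a a' * algebraMap ℂ 𝒜 (proj lam n a' (j, 1))) * B b 0 := by
    rw [Matrix.mul_apply, Fintype.sum_prod_type_right, sum_idx_one, Finset.sum_mul,
      Finset.sum_mul, sub_eq_add_neg, ← Finset.sum_neg_distrib, add_comm]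
    refine congrArg₂ _ (Finset.sum_congr rfl fun a' _ => ?_) (Finset.sum_congr rfl fun a' _ => ?_)
    · simp only [Matrix.kroneckerMap_apply, scal_apply, sing, Matrix.of_apply, one_ne_zero,
        if_false]
      rw [mul_assoc, mul_assoc, Algebra.commutes]
    · simp only [Matrix.kroneckerMap_apply, scal_apply, sing, Matrix.of_apply, if_true, map_neg]
      rw [mul_neg, mul_assoc, mul_assoc, Algebra.commutes]
  have e2 : (q • (scal 𝒜 (sing lam n) * G)) (a, b) j =
      ∑ i, ∑ d, proj lam n a (i, d) • (G i j * algebraMap ℂ 𝒜 (q * eps d b)) := by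
    rw [Matrix.smul_apply, Matrix.mul_apply, Finset.smul_sum]
    refine Finset.sum_congr rfl fun i _ => ?_
    rw [sum_idx_one, scal_apply, ← Algebra.smul_def, ← Algebra.commutes, ← Algebra.commutes,
      ← Algebra.smul_def, ← Algebra.smul_def, smul_smul, smul_smul, smul_smul, ← add_smul]
    congr 1
    have hb : b = 0 ∨ b = 1 := by fin_cases b <;> simp
    rcases hb with rfl | rfl <;> simp [sing, eps] <;> ring
  rw [e1, e2, hX, hX, Finset.sum_mul, Finset.sum_mul, ← Finset.sum_sub_distrib]
  refine Finset.sum_congr rfl fun i _ => ?_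
  rw [Finset.sum_mul, Finset.sum_mul, ← Finset.sum_sub_distrib]
  refine Finset.sum_congr rfl fun d _ => ?_
  rw [← hq, smul_mul_assoc, smul_mul_assoc, ← smul_sub, mul_sub, mul_assoc, mul_assoc]

/-! ### Transfer matrices -/

section Transfer

variable {m : ℕ}

/-- The twisted transfer matrix built from an operator on `V_l ⊗ V_m`. -/
def transfer (N : ℕ) {l : ℕ} (A : Matrix (Idx l × Idx m) (Idx l × Idx m) ℂ) :
    Matrix (Fin N → Idx m) (Fin N → Idx m) ℂ :=
  traceAux ((List.ofFn fun k : Fin N => emb N A k).prod *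
    (F l ⊗ₖ (1 : Matrix (Fin N → Idx m) (Fin N → Idx m) ℂ)))

theorem t_eq_transfer (lam : ℂ) (N l : ℕ) (u : ℂ) : t lam N m l u = transfer N (R lam l m u) := rfl

theorem traceAux_eq_trace {l : ℕ} {Q : Type} (A : Matrix (Idx l × Q) (Idx l × Q) ℂ) :
    traceAux A = Matrix.trace (blocks A) := by
  ext x y
  simp [traceAux, Matrix.trace, Matrix.sum_apply]

theorem transfer_eq_trace (N : ℕ) {l : ℕ} (A : Matrix (Idx l × Idx m) (Idx l × Idx m) ℂ) :
    transfer N A = Matrix.trace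
      (((List.finRange N).map fun k => (blocks A).map (site (Idx m) N k)).prod *
        scal (Matrix (Fin N → Idx m) (Fin N → Idx m) ℂ) (F l)) := by
  rw [transfer, traceAux_eq_trace, blocks_mul, blocks_kronecker_one, blocks_list_prod,
    List.ofFn_eq_map, List.map_map]
  rfl

theorem transfer_mul_transfer {lam : ℂ} (N : ℕ) {l : ℕ} (h : sinh ((l + 2 : ℕ) * lam) ≠ 0)
    (c d : ℂ) (A : Matrix (Idx (l + 1) × Idx m) (Idx (l + 1) × Idx m) ℂ)
    (B : Matrix (Idx 1 × Idx m) (Idx 1 × Idx m) ℂ)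
    (C : Matrix (Idx (l + 2) × Idx m) (Idx (l + 2) × Idx m) ℂ)
    (D : Matrix (Idx l × Idx m) (Idx l × Idx m) ℂ)
    (hC : scal (Matrix (Idx m) (Idx m) ℂ) (proj lam (l + 1)) * (blocks A ⊗ₖ blocks B) =
      c • (blocks C * scal (Matrix (Idx m) (Idx m) ℂ) (proj lam (l + 1))))
    (hD : (blocks A ⊗ₖ blocks B) * scal (Matrix (Idx m) (Idx m) ℂ) (sing lam l) =
      d • (scal (Matrix (Idx m) (Idx m) ℂ) (sing lam l) * blocks D)) :
    transfer N A * transfer N B = c ^ N • transfer N C - d ^ N • transfer N D := by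
  set 𝒜 := Matrix (Fin N → Idx m) (Fin N → Idx m) ℂ
  have hC' : ∀ k : Fin N, scal 𝒜 (proj lam (l + 1)) *
      ((blocks A).map (site (Idx m) N k) ⊗ₖ (blocks B).map (site (Idx m) N k)) =
      c • ((blocks C).map (site (Idx m) N k) * scal 𝒜 (proj lam (l + 1))) := by
    intro k
    have := congrArg (fun X => X.map (site (Idx m) N k)) hC
    simpa only [Matrix.map_mul, map_smul_matrix, map_scal, map_kronecker] using this
  have hD' : ∀ k : Fin N,
      ((blocks A).map (site (Idx m) N k) ⊗ₖ (blocks B).map (site (Idx m) N k)) *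
        scal 𝒜 (sing lam l) =
      d • (scal 𝒜 (sing lam l) * (blocks D).map (site (Idx m) N k)) := by
    intro k
    have := congrArg (fun X => X.map (site (Idx m) N k)) hD
    simpa only [Matrix.map_mul, map_smul_matrix, map_scal, map_kronecker] using this
  have hC'' := mul_list_prod_of_intertwine _ _ _ _ hC' (List.finRange N)
  have hD'' := list_prod_mul_of_intertwine _ _ _ _ hD' (List.finRange N)
  rw [List.length_finRange] at hC'' hD''
  have hAB := list_prod_kronecker_list_prod
    (fun k => (blocks A).map (site (Idx m) N k)) (fun k => (blocks B).map (site (Idx m) N k))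
    (fun s t hst i j i' j' => site_commute N hst (blocks A i j) (blocks B i' j'))
    (List.finRange N) (List.nodup_finRange N)
  rw [transfer_eq_trace, transfer_eq_trace, transfer_eq_trace, transfer_eq_trace,
    ← Matrix.trace_kronecker, mul_kronecker_mul_of_commute, hAB, ← scal_kronecker]
  swap
  · intro i j i' j'
    exact Algebra.commutes (F (l + 1) i j) _
  set X := ((List.finRange N).map fun k =>
    (blocks A).map (site (Idx m) N k) ⊗ₖ (blocks B).map (site (Idx m) N k)).prod
  set Y := ((List.finRange N).map fun k => (blocks C).map (site (Idx m) N k)).prod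
  set Z := ((List.finRange N).map fun k => (blocks D).map (site (Idx m) N k)).prod
  -- Insert the resolution of the identity; cyclicity then turns the trace into one over V_{l+2} and
  -- one over V_l.
  have e : X * scal 𝒜 (F (l + 1) ⊗ₖ F 1) =
      X * scal 𝒜 (F (l + 1) ⊗ₖ F 1) * scal 𝒜 (incl lam (l + 1)) * scal 𝒜 (proj lam (l + 1)) +
      X * scal 𝒜 (F (l + 1) ⊗ₖ F 1) * scal 𝒜 (sing lam l) * scal 𝒜 (cosing lam l) := by
    rw [Matrix.mul_assoc _ (scal 𝒜 (incl lam (l + 1))), Matrix.mul_assoc _ (scal 𝒜 (sing lam l)),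
      ← Matrix.mul_add, ← scal_mul, ← scal_mul, ← scal_add, incl_mul_proj_add h, scal_one,
      Matrix.mul_one]
  have e1 : scal 𝒜 (proj lam (l + 1)) *
      (X * scal 𝒜 (F (l + 1) ⊗ₖ F 1) * scal 𝒜 (incl lam (l + 1))) =
      c ^ N • (Y * scal 𝒜 (F (l + 2))) := by
    rw [← Matrix.mul_assoc, ← Matrix.mul_assoc, hC'', Matrix.smul_mul, Matrix.smul_mul,
      Matrix.mul_assoc Y, ← scal_mul, proj_mul_F, Matrix.mul_assoc Y, ← scal_mul,
      Matrix.mul_assoc (F _), proj_mul_incl h, Matrix.mul_one]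
  have e2 : scal 𝒜 (cosing lam l) * (X * scal 𝒜 (F (l + 1) ⊗ₖ F 1) * scal 𝒜 (sing lam l)) =
      -(d ^ N • (Z * scal 𝒜 (F l))) := by
    rw [Matrix.mul_assoc X, ← scal_mul, F_mul_sing, scal_neg, scal_mul, Matrix.mul_neg,
      ← Matrix.mul_assoc X, hD'', Matrix.mul_neg, Matrix.smul_mul, Matrix.mul_smul,
      Matrix.mul_assoc (scal 𝒜 (sing lam l)), ← Matrix.mul_assoc, ← scal_mul, cosing_mul_sing h,
      scal_one, Matrix.one_mul]
  rw [e, Matrix.trace_add, trace_mul_scal_comm, trace_mul_scal_comm, e1, e2, Matrix.trace_neg,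
    Matrix.trace_smul, Matrix.trace_smul, sub_eq_add_neg]

end Transfer

/-! ### Fusion in the auxiliary space -/

/-- The fused operator, defined with the right inverse `incl`, is genuinely the quotient operator.
This requires the kernel of `proj` to be invariant, which follows from the previous level and the
quantum determinant. -/
theorem proj_mul_fusedR (lam : ℂ) (m n : ℕ)
    (h : ∀ k : ℕ, 1 ≤ k → k ≤ n + 1 → sinh (k * lam) ≠ 0) (u : ℂ) :
    scal (Matrix (Idx m) (Idx m) ℂ) (proj lam n) *
        (blocks (fusedR lam m n (u + lam)) ⊗ₖ blocks (flip (Rl1 lam m u))) =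
      blocks (fusedR lam m (n + 1) u) * scal (Matrix (Idx m) (Idx m) ℂ) (proj lam n) := by
  induction n generalizing u with
  | zero =>
    have e : fusedR lam m 0 (u + lam) = 1 := rfl
    have e' : fusedR lam m (0 + 1) u = flip (Rl1 lam m u) := rfl
    rw [e, e', blocks_one]
    ext J ⟨a, b⟩ i j
    rw [scal_mul_apply, mul_scal_apply]
    -- On V_0 ⊗ V_1 ≅ V_1 the projection is the scalar √(sinh λ).
    have hP : ∀ (J : Idx (0 + 1)) (a : Idx 0) (b : Idx 1),
        proj lam 0 J (a, b) = if J = b then root lam 1 else 0 := by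
      intro J a b
      fin_cases J <;> fin_cases a <;> fin_cases b <;> simp [proj]
    have ha : a = 0 := by fin_cases a; rfl
    have hs : ∀ g : Idx 0 → ℂ, ∑ x, g x = g 0 := fun g => Fin.sum_univ_one g
    subst ha
    simp [Fintype.sum_prod_type, hP, hs, mul_comm]
  | succ n ih =>
    have h1 : sinh lam ≠ 0 := by simpa using h 1 le_rfl (by omega)
    have hn : sinh ((n + 2 : ℕ) * lam) ≠ 0 := h (n + 2) (by omega) le_rfl
    have hK := mul_sing_of_intertwine lam _ n _ _ _ _
      (ih (fun k hk hk' => h k hk (by omega)) (u + lam)) (quantum_det h1 m u)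
    have e : blocks (fusedR lam m (n + 1 + 1) u) = _ :=
      blocks_fuse lam (fusedR lam m (n + 1) (u + lam)) (flip (Rl1 lam m u))
    rw [e]
    set 𝒜 := Matrix (Idx m) (Idx m) ℂ
    set X := blocks (fusedR lam m (n + 1) (u + lam)) ⊗ₖ blocks (flip (Rl1 lam m u))
    have e2 : scal 𝒜 (proj lam (n + 1)) * X * scal 𝒜 (sing lam n) = 0 := by
      rw [Matrix.mul_assoc, hK, Matrix.mul_smul, ← Matrix.mul_assoc, ← scal_mul, proj_mul_sing,
        scal_zero, Matrix.zero_mul, smul_zero]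
    calc scal 𝒜 (proj lam (n + 1)) * X
        = scal 𝒜 (proj lam (n + 1)) * X * scal 𝒜 (incl lam (n + 1) * proj lam (n + 1) +
            sing lam n * cosing lam n) := by
          rw [incl_mul_proj_add hn, scal_one, Matrix.mul_one]
      _ = _ := by
          rw [scal_add, Matrix.mul_add, scal_mul, scal_mul, ← Matrix.mul_assoc,
            ← Matrix.mul_assoc _ (scal 𝒜 (sing lam n)), e2, Matrix.zero_mul, add_zero]

theorem fusedR_mul_sing (lam : ℂ) (m n : ℕ)
    (h : ∀ k : ℕ, 1 ≤ k → k ≤ n + 1 → sinh (k * lam) ≠ 0) (u : ℂ) :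
    (blocks (fusedR lam m (n + 1) (u + lam)) ⊗ₖ blocks (flip (Rl1 lam m u))) *
        scal (Matrix (Idx m) (Idx m) ℂ) (sing lam n) =
      (sinh u * sinh (u + (m + 1) * lam)) • (scal (Matrix (Idx m) (Idx m) ℂ) (sing lam n) *
        blocks (fusedR lam m n (u + lam + lam))) := by
  have h1 : sinh lam ≠ 0 := by simpa using h 1 le_rfl (by omega)
  exact mul_sing_of_intertwine lam _ n _ _ _ _ (proj_mul_fusedR lam m n h (u + lam))
    (quantum_det h1 m u)

/-! ### Fusion in the quantum space -/

section Intertwines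

variable {α β γ δ ρ σ : Type*} [Fintype ρ] [Fintype σ]

/-- `W` intertwines the entries of `X` and `Y`. -/
def Intertwines (W : Matrix ρ σ ℂ) (X : Matrix α β (Matrix ρ ρ ℂ))
    (Y : Matrix α β (Matrix σ σ ℂ)) : Prop :=
  ∀ a b, X a b * W = W * Y a b

theorem Intertwines.kronecker {W : Matrix ρ σ ℂ} {X : Matrix α β (Matrix ρ ρ ℂ)}
    {Y : Matrix α β (Matrix σ σ ℂ)} {X' : Matrix γ δ (Matrix ρ ρ ℂ)}
    {Y' : Matrix γ δ (Matrix σ σ ℂ)} (h : Intertwines W X Y) (h' : Intertwines W X' Y') :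
    Intertwines W (X ⊗ₖ X') (Y ⊗ₖ Y') := by
  rintro ⟨a, c⟩ ⟨b, d⟩
  simp only [Matrix.kroneckerMap_apply]
  rw [Matrix.mul_assoc, h' c d, ← Matrix.mul_assoc, h a b, Matrix.mul_assoc]

theorem Intertwines.scal_mul [DecidableEq ρ] [DecidableEq σ] [Fintype β]
    {W : Matrix ρ σ ℂ} {X : Matrix β γ (Matrix ρ ρ ℂ)}
    {Y : Matrix β γ (Matrix σ σ ℂ)} (h : Intertwines W X Y) (M : Matrix α β ℂ) :
    Intertwines W (scal (Matrix ρ ρ ℂ) M * X) (scal (Matrix σ σ ℂ) M * Y) := by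
  intro a b
  simp only [Matrix.mul_apply, scal_apply, ← Algebra.smul_def]
  rw [Matrix.sum_mul, Matrix.mul_sum]
  refine Finset.sum_congr rfl fun p _ => ?_
  rw [Matrix.smul_mul, Matrix.mul_smul, h p b]

theorem Intertwines.mul_scal [DecidableEq ρ] [DecidableEq σ] [Fintype β]
    {W : Matrix ρ σ ℂ} {X : Matrix α β (Matrix ρ ρ ℂ)}
    {Y : Matrix α β (Matrix σ σ ℂ)} (h : Intertwines W X Y) (M : Matrix β γ ℂ) :
    Intertwines W (X * scal (Matrix ρ ρ ℂ) M) (Y * scal (Matrix σ σ ℂ) M) := by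
  intro a b
  simp only [Matrix.mul_apply, scal_apply, ← Algebra.commutes, ← Algebra.smul_def]
  rw [Matrix.sum_mul, Matrix.mul_sum]
  refine Finset.sum_congr rfl fun p _ => ?_
  rw [Matrix.smul_mul, Matrix.mul_smul, h a p]

theorem Intertwines.smul {W : Matrix ρ σ ℂ} {X : Matrix α β (Matrix ρ ρ ℂ)}
    {Y : Matrix α β (Matrix σ σ ℂ)} (h : Intertwines W X Y) (c : ℂ) :
    Intertwines W (c • X) (c • Y) := by
  intro a b
  rw [Matrix.smul_apply, Matrix.smul_apply, Matrix.smul_mul, Matrix.mul_smul, h a b]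

/-- An operator is determined by what it is intertwined with, if `W` has a right inverse. -/
theorem Intertwines.left_unique [DecidableEq ρ] {W : Matrix ρ σ ℂ} {W' : Matrix σ ρ ℂ}
    (hW : W * W' = 1)
    {X X' : Matrix α β (Matrix ρ ρ ℂ)} {Y : Matrix α β (Matrix σ σ ℂ)}
    (h : Intertwines W X Y) (h' : Intertwines W X' Y) : X = X' := by
  ext a b : 2
  rw [← Matrix.mul_one (X a b), ← Matrix.mul_one (X' a b), ← hW, ← Matrix.mul_assoc,
    ← Matrix.mul_assoc, h a b, h' a b]

end Intertwines

/-- A fusion identity in the auxiliary space, reread entry by entry with the roles of the two spaces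
exchanged. -/
theorem intertwines_flip {lam : ℂ} {m l : ℕ} {X : Matrix (Idx m × Idx l) (Idx m × Idx l) ℂ}
    {Y : Matrix (Idx 1 × Idx l) (Idx 1 × Idx l) ℂ}
    {Z : Matrix (Idx (m + 1) × Idx l) (Idx (m + 1) × Idx l) ℂ}
    (h : scal (Matrix (Idx l) (Idx l) ℂ) (proj lam m) * (blocks X ⊗ₖ blocks Y) =
      blocks Z * scal (Matrix (Idx l) (Idx l) ℂ) (proj lam m)) :
    Intertwines (proj lam m) (blocks (flip Z))
      ((blocks (flip X)).map (leftFactor (Idx m) (Idx 1)) *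
        (blocks (flip Y)).map (rightFactor (Idx m) (Idx 1))) := by
  intro a b
  ext J ⟨i, c⟩
  have := congrFun (congrFun (congrFun (congrFun h J) (i, c)) a) b
  rw [scal_mul_apply, mul_scal_apply] at this
  refine Eq.trans (Eq.trans ?_ this.symm) ?_
  · rw [Matrix.mul_apply]
    rfl
  · rw [Matrix.mul_apply]
    refine Finset.sum_congr rfl fun p _ => ?_
    simp [Matrix.mul_apply (M := (blocks (flip X)).map _), leftFactor_mul_rightFactor,
      Matrix.sum_apply, Matrix.mul_apply (M := blocks X p.1 i)]

/-- The zeros of sinh are isolated along real translates: where sinh(u + c) = 0, cosh(u + c) ≠ 0 and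
sinh(u + c + x) = cosh(u + c) sinh x. Continuity fills the gap. -/
theorem eq_of_sinh_smul_eq {E : Type*} [AddCommGroup E] [Module ℂ E] [TopologicalSpace E]
    [T2Space E] {g g' : ℂ → E} (hg : Continuous g) (hg' : Continuous g') (c : ℂ)
    (h : ∀ u, sinh (u + c) • g u = sinh (u + c) • g' u) (u : ℂ) : g u = g' u := by
  by_cases hu : sinh (u + c) = 0
  · have key : (fun x : ℝ => g (u + x)) = fun x : ℝ => g' (u + x) := by
      refine Continuous.ext_on (dense_compl_singleton (0 : ℝ)) (by fun_prop) (by fun_prop) ?_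
      intro x hx
      have hx' : sinh (x : ℂ) ≠ 0 := by
        rw [← Complex.ofReal_sinh]
        exact_mod_cast (Real.sinh_eq_zero.not.mpr hx)
      have hc : cosh (u + c) ≠ 0 := by
        intro hc
        have := Complex.cosh_sq (u + c)
        rw [hu, hc] at this
        norm_num at this
      have hs : sinh (u + x + c) ≠ 0 := by
        rw [add_right_comm, Complex.sinh_add, hu, zero_mul, zero_add]
        exact mul_ne_zero hc hx'
      exact smul_right_injective E hs (h (u + x))
    simpa using congrFun key 0
  · exact smul_right_injective E hu (h u)

theorem eq_of_prod_sinh_smul_eq {E : Type*} [AddCommGroup E] [Module ℂ E] [TopologicalSpace E]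
    [T2Space E] [ContinuousSMul ℂ E] (n : ℕ) (c : ℕ → ℂ) {g g' : ℂ → E} (hg : Continuous g)
    (hg' : Continuous g')
    (h : ∀ u, (∏ k ∈ Finset.range n, sinh (u + c k)) • g u =
      (∏ k ∈ Finset.range n, sinh (u + c k)) • g' u) (u : ℂ) : g u = g' u := by
  have hs : ∀ k, Continuous fun u => sinh (u + c k) := fun k =>
    Complex.continuous_sinh.comp (continuous_add_const _)
  induction n generalizing g g' u with
  | zero => simpa using h u
  | succ n ih =>
    refine eq_of_sinh_smul_eq hg hg' (c n) (fun v => ?_) u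
    exact ih (g := fun v => sinh (v + c n) • g v) (g' := fun v => sinh (v + c n) • g' v)
      ((hs n).smul hg) ((hs n).smul hg') (fun v => by
        simpa only [Finset.prod_range_succ, mul_smul] using h v) v

theorem continuous_Rl1 (lam : ℂ) (m : ℕ) : Continuous (Rl1 lam m) := by
  refine continuous_matrix fun p q => ?_
  by_cases h : p = q
  · simp only [Rl1, Matrix.add_apply, h, Matrix.diagonal_apply_eq]
    exact (Complex.continuous_sinh.comp (continuous_add_const _)).add continuous_const
  · simp only [Rl1, Matrix.add_apply, Matrix.diagonal_apply_ne _ h]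
    exact continuous_const

theorem continuous_flip {m l : ℕ} {A : ℂ → Matrix (Idx m × Idx l) (Idx m × Idx l) ℂ}
    (hA : Continuous A) : Continuous fun u => flip (A u) :=
  hA.matrix_submatrix _ _

theorem continuous_blocks {α β Q : Type*} {A : ℂ → Matrix (α × Q) (β × Q) ℂ}
    (hA : Continuous A) : Continuous fun u => blocks (A u) :=
  continuous_matrix fun _ _ => continuous_matrix fun _ _ => hA.matrix_elem _ _

theorem continuous_kronecker {α β γ δ Q : Type*} [Fintype Q]
    {A : ℂ → Matrix α β (Matrix Q Q ℂ)} {B : ℂ → Matrix γ δ (Matrix Q Q ℂ)}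
    (hA : Continuous A) (hB : Continuous B) : Continuous fun u => A u ⊗ₖ B u :=
  continuous_matrix fun _ _ => (hA.matrix_elem _ _).matrix_mul (hB.matrix_elem _ _)

theorem continuous_fusedR (lam : ℂ) (m l : ℕ) : Continuous (fusedR lam m l) := by
  induction l with
  | zero => exact continuous_const
  | succ l ih =>
    cases l with
    | zero => exact continuous_flip (continuous_Rl1 lam m)
    | succ l =>
      have hA : Continuous fun u => fusedR lam m (l + 1) (u + lam) :=
        ih.comp (continuous_add_const _)
      have hB : Continuous fun u => flip (Rl1 lam m u) := continuous_flip (continuous_Rl1 lam m)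
      have h13 : Continuous fun u => emb13 (fusedR lam m (l + 1) (u + lam)) :=
        continuous_matrix fun p q => by
          simp only [emb13, Matrix.of_apply]
          split_ifs
          · exact hA.matrix_elem _ _
          · exact continuous_const
      have h23 : Continuous fun u => emb23 (l + 1) (flip (Rl1 lam m u)) :=
        continuous_matrix fun p q => by
          simp only [emb23, Matrix.of_apply]
          split_ifs
          · exact hB.matrix_elem _ _
          · exact continuous_const
      exact (continuous_const.matrix_mul (h13.matrix_mul h23)).matrix_mul continuous_const

/-- The quantum space V_{m+1} is a quotient of V_m ⊗ V_1, and the identity is inherited from its two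
factors: induction on the left one, `proj_mul_Rl1` on the right one. Their entries commute, so the
two fusions can be carried out separately. -/
theorem proj_mul_flip_fusedR (lam : ℂ) (m : ℕ)
    (h : ∀ k : ℕ, 1 ≤ k → k ≤ m + 1 → sinh (k * lam) ≠ 0) (l : ℕ) (u : ℂ) :
    scal (Matrix (Idx (m + 1)) (Idx (m + 1)) ℂ) (proj lam l) *
        (blocks (flip (fusedR lam l (m + 1) (u + lam))) ⊗ₖ blocks (flip (Rl1 lam (m + 1) u))) =
      sinh (u + (m + 1 : ℕ) * lam) • (blocks (flip (fusedR lam (l + 1) (m + 1) u)) *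
        scal (Matrix (Idx (m + 1)) (Idx (m + 1)) ℂ) (proj lam l)) := by
  have h1 : sinh lam ≠ 0 := by simpa using h 1 le_rfl (by omega)
  induction m generalizing l u with
  | zero =>
    have e : ∀ l u, flip (fusedR lam l (0 + 1) u) = Rl1 lam l u := fun _ _ => rfl
    have := proj_mul_Rl1 h1 l u
    rw [blocks_smul, Matrix.smul_mul] at this
    rw [e, e]
    simpa [flip_Rl1_one h1] using this
  | succ m ih =>
    have hm : sinh ((m + 1 + 1 : ℕ) * lam) ≠ 0 := h _ (by omega) le_rfl
    -- By `hB` the explicit R-matrix comes with a factor sinh(v + λ), so the identity first appears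
    -- multiplied by it.
    refine eq_of_sinh_smul_eq
      (g := fun v => scal (Matrix (Idx (m + 1 + 1)) (Idx (m + 1 + 1)) ℂ) (proj lam l) *
        (blocks (flip (fusedR lam l (m + 1 + 1) (v + lam))) ⊗ₖ
          blocks (flip (Rl1 lam (m + 1 + 1) v))))
      (g' := fun v => sinh (v + (m + 1 + 1 : ℕ) * lam) •
        (blocks (flip (fusedR lam (l + 1) (m + 1 + 1) v)) *
          scal (Matrix (Idx (m + 1 + 1)) (Idx (m + 1 + 1)) ℂ) (proj lam l)))
      ?_ ?_ lam (fun v => ?_) u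
    · exact continuous_const.matrix_mul (continuous_kronecker
        (continuous_blocks (continuous_flip
          ((continuous_fusedR _ _ _).comp (continuous_add_const _))))
        (continuous_blocks (continuous_flip (continuous_Rl1 _ _))))
    · exact (Complex.continuous_sinh.comp (continuous_add_const _)).smul
        ((continuous_blocks (continuous_flip (continuous_fusedR _ _ _))).matrix_mul
          continuous_const)
    clear u
    have hA := intertwines_flip (proj_mul_fusedR lam l (m + 1) h (v + lam))
    have hC := intertwines_flip (proj_mul_fusedR lam (l + 1) (m + 1) h v)
    have hB := intertwines_flip (proj_mul_Rl1 h1 (m + 1) v)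
    rw [flip_Rl1_one h1] at hB
    rw [flip_flip] at hA hC
    have hL := congrArg (fun X => X.map (leftFactor (Idx (m + 1)) (Idx 1)))
      (ih (fun k hk hk' => h k hk (by omega)) l (v + lam))
    have hR := congrArg (fun X => X.map (rightFactor (Idx (m + 1)) (Idx 1)))
      (proj_mul_Rl1 h1 l v)
    simp only [blocks_smul, Matrix.map_mul, map_smul_matrix, map_scal, map_kronecker] at hL hR
    have hAB := (hA.kronecker hB).scal_mul (proj lam l)
    rw [mul_kronecker_mul_of_commute, ← Matrix.mul_assoc, hL, Matrix.smul_mul, Matrix.mul_assoc,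
      hR, Matrix.smul_mul, Matrix.mul_smul, smul_smul, ← Matrix.mul_assoc] at hAB
    swap
    · intro i j i' j'
      exact commute_rightFactor_leftFactor _ _
    have hC' := (hC.mul_scal (proj lam l)).smul
      (sinh (v + lam + (m + 1 : ℕ) * lam) * sinh (v + lam))
    -- Both sides are intertwined by a right-invertible map with the same operator on V_{m+1} ⊗ V_1.
    have := Intertwines.left_unique (proj_mul_incl hm) hAB hC'
    rw [flip_smul, blocks_smul, Matrix.kronecker_smul, Matrix.mul_smul] at this
    rw [this, smul_smul, mul_comm (sinh (v + lam))]
    push_cast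
    ring_nf

/-- The factor sinh(u + (m+2)λ) of the quantum determinant also appears in `proj_mul_flip_fusedR` at
u + λ, and cancels. -/
theorem flip_fusedR_mul_sing (lam : ℂ) (m : ℕ)
    (h : ∀ k : ℕ, 1 ≤ k → k ≤ m + 1 → sinh (k * lam) ≠ 0) (l : ℕ) (u : ℂ) :
    (blocks (flip (fusedR lam (l + 1) (m + 1) (u + lam))) ⊗ₖ blocks (flip (Rl1 lam (m + 1) u))) *
        scal (Matrix (Idx (m + 1)) (Idx (m + 1)) ℂ) (sing lam l) =
      sinh u • (scal (Matrix (Idx (m + 1)) (Idx (m + 1)) ℂ) (sing lam l) *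
        blocks (flip (fusedR lam l (m + 1) (u + lam + lam)))) := by
  have h1 : sinh lam ≠ 0 := by simpa using h 1 le_rfl (by omega)
  refine eq_of_sinh_smul_eq
    (g := fun v => (blocks (flip (fusedR lam (l + 1) (m + 1) (v + lam))) ⊗ₖ
        blocks (flip (Rl1 lam (m + 1) v))) *
      scal (Matrix (Idx (m + 1)) (Idx (m + 1)) ℂ) (sing lam l))
    (g' := fun v => sinh v • (scal (Matrix (Idx (m + 1)) (Idx (m + 1)) ℂ) (sing lam l) *
      blocks (flip (fusedR lam l (m + 1) (v + lam + lam)))))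
    ?_ ?_ ((m + 2) * lam) (fun v => ?_) u
  · exact (continuous_kronecker
      (continuous_blocks (continuous_flip
        ((continuous_fusedR _ _ _).comp (continuous_add_const _))))
      (continuous_blocks (continuous_flip (continuous_Rl1 _ _)))).matrix_mul continuous_const
  · exact Complex.continuous_sinh.smul (continuous_const.matrix_mul
      (continuous_blocks (continuous_flip ((continuous_fusedR _ _ _).comp
        ((continuous_add_const _).comp (continuous_add_const _))))))
  have hP := proj_mul_flip_fusedR lam m h l (v + lam)
  rw [← Matrix.smul_mul] at hP
  have := mul_sing_of_intertwine lam _ l _ _ _ _ hP (quantum_det h1 (m + 1) v)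
  rw [Matrix.smul_kronecker, Matrix.smul_mul] at this
  have e1 : v + lam + (m + 1 : ℕ) * lam = v + (m + 2) * lam := by push_cast; ring
  have e2 : v + ((m + 1 : ℕ) + 1) * lam = v + (m + 2) * lam := by push_cast; ring
  rw [e1, e2] at this
  rw [this, smul_smul, mul_comm]

/-! ### Symmetry of the fused R-matrices -/

theorem fusedR_one_eq (lam : ℂ) (n : ℕ)
    (h : ∀ k : ℕ, 1 ≤ k → k ≤ n + 1 → sinh (k * lam) ≠ 0) (u : ℂ) :
    fusedR lam 1 (n + 1) u =
      (∏ k ∈ Finset.range n, sinh (u + ((k + 1 : ℕ) : ℂ) * lam)) • Rl1 lam (n + 1) u := by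
  have h1 : sinh lam ≠ 0 := by simpa using h 1 le_rfl (by omega)
  induction n generalizing u with
  | zero =>
    have e : fusedR lam 1 (0 + 1) u = flip (Rl1 lam 1 u) := rfl
    simp [e, flip_Rl1_one h1]
  | succ n ih =>
    have hn : sinh ((n + 1 + 1 : ℕ) * lam) ≠ 0 := h _ (by omega) le_rfl
    have e : fusedR lam 1 (n + 1 + 1) u =
      fuse lam (fusedR lam 1 (n + 1) (u + lam)) (flip (Rl1 lam 1 u)) := rfl
    apply blocks_injective
    rw [e, blocks_fuse, ih (fun k hk hk' => h k hk (by omega)), blocks_smul,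
      Matrix.smul_kronecker, Matrix.mul_smul, flip_Rl1_one h1, proj_mul_Rl1 h1, Matrix.smul_mul,
      Matrix.mul_assoc, ← scal_mul, proj_mul_incl hn, scal_one, Matrix.mul_one, blocks_smul,
      blocks_smul, smul_smul, Finset.prod_range_succ']
    congr 2
    · refine Finset.prod_congr rfl fun k _ => ?_
      push_cast
      ring_nf
    · simp

/-- Fusing the first or the second space gives the same operator up to normalisation; each step on
the left raises the level by `proj_mul_flip_fusedR` and collects its scalar on the right. At l = m
the two products coincide. -/
theorem prod_smul_fusedR (lam : ℂ) (m l : ℕ)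
    (hm : ∀ k : ℕ, 1 ≤ k → k ≤ m + 1 → sinh (k * lam) ≠ 0)
    (hl : ∀ k : ℕ, 1 ≤ k → k ≤ l + 1 → sinh (k * lam) ≠ 0) (u : ℂ) :
    (∏ k ∈ Finset.range m, sinh (u + ((k + 1 + l : ℕ) : ℂ) * lam)) •
        fusedR lam (m + 1) (l + 1) u =
      (∏ k ∈ Finset.range l, sinh (u + ((k + 1 + m : ℕ) : ℂ) * lam)) •
        flip (fusedR lam (l + 1) (m + 1) u) := by
  induction l generalizing u with
  | zero =>
    have e : fusedR lam (m + 1) (0 + 1) u = flip (Rl1 lam (m + 1) u) := rfl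
    rw [e, fusedR_one_eq lam m hm]
    simp [flip_smul]
  | succ l ih =>
    have hn : sinh ((l + 1 + 1 : ℕ) * lam) ≠ 0 := hl _ (by omega) le_rfl
    have e : fusedR lam (m + 1) (l + 1 + 1) u =
      fuse lam (fusedR lam (m + 1) (l + 1) (u + lam)) (flip (Rl1 lam (m + 1) u)) := rfl
    have e1 : ∏ k ∈ Finset.range m, sinh (u + ((k + 1 + (l + 1) : ℕ) : ℂ) * lam) =
        ∏ k ∈ Finset.range m, sinh (u + lam + ((k + 1 + l : ℕ) : ℂ) * lam) := by
      refine Finset.prod_congr rfl fun k _ => ?_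
      push_cast
      ring_nf
    apply blocks_injective
    have ih' := congrArg blocks (ih (fun k hk hk' => hl k hk (by omega)) (u + lam))
    rw [blocks_smul, blocks_smul] at ih'
    rw [e, e1, blocks_smul, blocks_fuse, ← Matrix.smul_mul, ← Matrix.mul_smul,
      ← Matrix.smul_kronecker, ih', Matrix.smul_kronecker, Matrix.mul_smul,
      proj_mul_flip_fusedR lam m hm, smul_smul, Matrix.smul_mul, Matrix.mul_assoc, ← scal_mul,
      proj_mul_incl hn, scal_one, Matrix.mul_one, blocks_smul, Finset.prod_range_succ']
    congr 2
    · refine Finset.prod_congr rfl fun k _ => ?_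
      push_cast
      ring_nf
    · push_cast
      ring_nf

theorem flip_fusedR_self (lam : ℂ) (m : ℕ)
    (hm : ∀ k : ℕ, 1 ≤ k → k ≤ m + 1 → sinh (k * lam) ≠ 0) (u : ℂ) :
    flip (fusedR lam (m + 1) (m + 1) u) = fusedR lam (m + 1) (m + 1) u :=
  (eq_of_prod_sinh_smul_eq m (fun k => ((k + 1 + m : ℕ) : ℂ) * lam) (continuous_fusedR _ _ _)
    (continuous_flip (continuous_fusedR _ _ _)) (prod_smul_fusedR lam m m hm hm) u).symm

theorem R_of_le {lam : ℂ} {l m : ℕ} (h : l ≤ m) (u : ℂ) : R lam l m u = fusedR lam m l u :=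
  if_pos h

/-- The boundary case of equal spins, where `R` is defined without the flip, is covered by symmetry.
-/
theorem R_of_ge {lam : ℂ} {l m : ℕ} (h : m + 1 ≤ l)
    (hm : ∀ k : ℕ, 1 ≤ k → k ≤ m + 1 → sinh (k * lam) ≠ 0) (u : ℂ) :
    R lam l (m + 1) u = flip (fusedR lam l (m + 1) u) := by
  rcases h.eq_or_lt with rfl | h
  · rw [R_of_le le_rfl, flip_fusedR_self lam m hm]
  · exact if_neg (by omega)

end TwistedXXZ

open TwistedXXZ in
theorem proposition2 (lam u : ℂ) (N twoS l : ℕ) (hs : 1 ≤ twoS) (hl : 1 ≤ l)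
    (hlam : ∀ k : ℕ, 1 ≤ k → k ≤ l + 1 → Complex.sinh (k * lam) ≠ 0) :
    (l < twoS →
      TwistedXXZ.t lam N twoS l (u + lam) * TwistedXXZ.t lam N twoS 1 u =
        TwistedXXZ.t lam N twoS (l + 1) u -
          (Complex.sinh u ^ N * Complex.sinh (u + lam * (twoS + 1)) ^ N) •
            TwistedXXZ.t lam N twoS (l - 1) (u + 2 * lam)) ∧
    (l = twoS →
      TwistedXXZ.t lam N twoS l (u + lam) * TwistedXXZ.t lam N twoS 1 u =
        Complex.sinh (u + twoS * lam) ^ N • TwistedXXZ.t lam N twoS (l + 1) u -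
          (Complex.sinh u ^ N * Complex.sinh (u + lam * (twoS + 1)) ^ N) •
            TwistedXXZ.t lam N twoS (l - 1) (u + 2 * lam)) ∧
    (twoS < l →
      TwistedXXZ.t lam N twoS l (u + lam) * TwistedXXZ.t lam N twoS 1 u =
        Complex.sinh (u + twoS * lam) ^ N • TwistedXXZ.t lam N twoS (l + 1) u -
          Complex.sinh u ^ N • TwistedXXZ.t lam N twoS (l - 1) (u + 2 * lam)) := by
  obtain ⟨l, rfl⟩ : ∃ n, l = n + 1 := ⟨l - 1, by omega⟩
  obtain ⟨m, rfl⟩ : ∃ n, twoS = n + 1 := ⟨twoS - 1, by omega⟩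
  have hn : Complex.sinh ((l + 2 : ℕ) * lam) ≠ 0 := hlam (l + 2) (by omega) le_rfl
  have h2 : u + 2 * lam = u + lam + lam := by ring
  have hB : R lam 1 (m + 1) u = TwistedXXZ.flip (Rl1 lam (m + 1) u) := R_of_le (by omega) u
  simp only [Nat.add_sub_cancel, t_eq_transfer, hB, h2, ← mul_pow, mul_comm lam]
  refine ⟨fun hlt => ?_, fun heq => ?_, fun hgt => ?_⟩
  · rw [R_of_le (by omega), R_of_le (by omega), R_of_le (by omega)]
    -- All operators are fused in the auxiliary space, so the constant of the V_{l+2} term is 1.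
    have := transfer_mul_transfer (m := m + 1) N hn 1 _ _ _ _ _
      (by rw [one_smul]; exact proj_mul_fusedR lam (m + 1) (l + 1) hlam u)
      (fusedR_mul_sing lam (m + 1) l (fun k hk hk' => hlam k hk (by omega)) u)
    rwa [one_pow, one_smul] at this
  · obtain rfl : l = m := by omega
    have hm : ∀ k : ℕ, 1 ≤ k → k ≤ l + 1 → Complex.sinh (k * lam) ≠ 0 :=
      fun k hk hk' => hlam k hk (by omega)
    rw [R_of_le (l := l) (by omega), R_of_ge (l := l + 1 + 1) (by omega) hm,
      R_of_le (l := l + 1) le_rfl]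
    refine transfer_mul_transfer N hn _ _ _ _ _ _ ?_ (fusedR_mul_sing lam (l + 1) l hm u)
    -- The V_{l+2} term is fused in the quantum space and the V_l term in the auxiliary one;
    -- symmetry at equal spins lets the same operator serve both.
    rw [← flip_fusedR_self lam l hm]
    exact proj_mul_flip_fusedR lam l hm (l + 1) u
  · have hm : ∀ k : ℕ, 1 ≤ k → k ≤ m + 1 → Complex.sinh (k * lam) ≠ 0 :=
      fun k hk hk' => hlam k hk (by omega)
    rw [R_of_ge (by omega) hm, R_of_ge (by omega) hm, R_of_ge (by omega) hm]
    exact transfer_mul_transfer N hn _ _ _ _ _ _ (proj_mul_flip_fusedR lam m hm (l + 1) u)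
      (flip_fusedR_mul_sing lam m hm l u)

end
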